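/- Let $\mathbb S^2=\{x\in\mathbb E^3:\|x\|=1\}$. For $x\in\mathbb S^2$ and $r\in(0,\frac{\pi}{2}]$, the (closed) spherical cap with center $x$ and angular radius $r$ is $\{y\in\mathbb S^2:\langle x,y\rangle\ge\cos r\}$. A great circle is the intersection of $\mathbb S^2$ with a plane through the origin. A family of spherical caps of $\mathbb S^2$ is a totally separable packing (TS-packing) if any two of its caps can be separated by a great circle (that is, they lie in different closed hemispheres bounded by it) which is disjoint from the interior of each cap of the family. For $k>1$ let $r_{\rm STam}(k,\mathbb S^2)$ be the largest $r>0$ such that there exists a TS-packing of $k$ spherical caps of angular radius $r$ in $\mathbb S^2$; a TS-packing of $k$ spherical caps of angular radius $r_{\rm STam}(k,\mathbb S^2)$ is called $k$-optimal. Three mutually orthogonal great circles divide $\mathbb S^2$ into eight regular spherical triangles of side length $\frac{\pi}{2}$; the family of the inscribed caps of these eight triangles is called an octahedral TS-packing. The side lines (great circles containing the sides) of a regular spherical triangle of side length $\arccos\frac14$ divide $\mathbb S^2$ into two regular spherical triangles of side length $\arccos\frac14$ and six isosceles spherical triangles of side lengths $\pi-\arccos\frac14,\ \pi-\arccos\frac14,\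 \arccos\frac14$; the family of the inscribed caps of these six isosceles triangles is called a cuboctahedral TS-packing. **Theorem.** For $5\le k\le 6$, the maximum $r_{\rm STam}(k,\mathbb S^2)$ exists and equals $\arctan\frac34$, and every $k$-optimal TS-packing is a subfamily of a cuboctahedral TS-packing. For $7\le k\le 8$, the maximum $r_{\rm STam}(k,\mathbb S^2)$ exists and equals $\arcsin\frac{1}{\sqrt3}$, and every $k$-optimal TS-packing is a subfamily of an octahedral TS-packing. -/

import Mathlib

/-- The unit sphere of Euclidean 3-space. -/
abbrev S2 : Type := Metric.sphere (0 : EuclideanSpace ℝ (Fin 3)) 1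

/-- The spherical distance of two points of the sphere. -/
noncomputable def sphDist (x y : S2) : ℝ :=
  InnerProductGeometry.angle (x : EuclideanSpace ℝ (Fin 3)) (y : EuclideanSpace ℝ (Fin 3))

/-- The closed spherical cap with center `x` and angular radius `r`; it is meant for
`0 < r ≤ π / 2`. -/
def cap (x : S2) (r : ℝ) : Set S2 := {y | sphDist x y ≤ r}

/-- `C` is a spherical cap of angular radius `r`. -/
def IsCapOfRadius (r : ℝ) (C : Set S2) : Prop :=
  0 < r ∧ r ≤ Real.pi / 2 ∧ ∃ x : S2, C = cap x r

/-- The great circle with unit normal `u`, that is, the intersection of the sphere with the plane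
through the origin orthogonal to `u`. -/
def greatCircle (u : S2) : Set S2 :=
  {y | inner ℝ (u : EuclideanSpace ℝ (Fin 3)) (y : EuclideanSpace ℝ (Fin 3)) = 0}

/-- The closed hemisphere with pole `u`; it is bounded by `greatCircle u`. -/
def hemisphere (u : S2) : Set S2 :=
  {y | 0 ≤ inner ℝ (u : EuclideanSpace ℝ (Fin 3)) (y : EuclideanSpace ℝ (Fin 3))}

/-- The great circle with unit normal `u` separates `C` and `D`: they lie in different closed
hemispheres bounded by it. -/
def Separates (u : S2) (C D : Set S2) : Prop :=
  (C ⊆ hemisphere u ∧ D ⊆ hemisphere (-u)) ∨ (C ⊆ hemisphere (-u) ∧ D ⊆ hemisphere u)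

/-- A totally separable packing: a family of spherical caps any two (different) members of which
can be separated by a great circle that is disjoint from the interior of every member. -/
def IsTSPacking (F : Set (Set S2)) : Prop :=
  (∀ C ∈ F, ∃ r, IsCapOfRadius r C) ∧
  ∀ C ∈ F, ∀ D ∈ F, C ≠ D →
    ∃ u : S2, Separates u C D ∧ ∀ B ∈ F, Disjoint (greatCircle u) (interior B)

/-- `F` is a TS-packing of `k` spherical caps of angular radius `r`. -/
def IsTSPackingOf (k : ℕ) (r : ℝ) (F : Set (Set S2)) : Prop :=
  IsTSPacking F ∧ F.encard = k ∧ ∀ C ∈ F, IsCapOfRadius r C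

/-- The radii `r` for which there is a TS-packing of `k` spherical caps of angular radius `r`. -/
def tsRadii (k : ℕ) : Set ℝ := {r | ∃ F : Set (Set S2), IsTSPackingOf k r F}

/-- The solution of the separable Tammes problem for `k` caps. -/
noncomputable def rSTam (k : ℕ) : ℝ := sSup (tsRadii k)

/-- `F` is a `k`-optimal TS-packing. -/
def IsOptimal (k : ℕ) (F : Set (Set S2)) : Prop := IsTSPackingOf k (rSTam k) F

/-- The spherical segment with end points `a`, `b` (which are not antipodal). -/
def sphArc (a b : S2) : Set S2 :=
  {y | ∃ s t : ℝ, 0 ≤ s ∧ 0 ≤ t ∧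
    (y : EuclideanSpace ℝ (Fin 3)) =
      s • (a : EuclideanSpace ℝ (Fin 3)) + t • (b : EuclideanSpace ℝ (Fin 3))}

/-- The spherical triangle with vertices `a`, `b`, `c` (which are linearly independent). -/
def sphTriangle (a b c : S2) : Set S2 :=
  {y | ∃ s t w : ℝ, 0 ≤ s ∧ 0 ≤ t ∧ 0 ≤ w ∧
    (y : EuclideanSpace ℝ (Fin 3)) =
      s • (a : EuclideanSpace ℝ (Fin 3)) + t • (b : EuclideanSpace ℝ (Fin 3)) +
        w • (c : EuclideanSpace ℝ (Fin 3))}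

/-- `C` is the inscribed cap of the spherical triangle with vertices `a`, `b`, `c`: a spherical
cap that lies in the triangle and touches each of its sides. -/
def IsInscribedCap (C : Set S2) (a b c : S2) : Prop :=
  (∃ r, IsCapOfRadius r C) ∧ C ⊆ sphTriangle a b c ∧
    (C ∩ sphArc a b).Nonempty ∧ (C ∩ sphArc b c).Nonempty ∧ (C ∩ sphArc c a).Nonempty

/-- An octahedral TS-packing. Three mutually orthogonal great circles meet in the six points
`±a`, `±b`, `±c` with `a`, `b`, `c` mutually orthogonal, and the triangles into which they divide
the sphere are the eight triangles with vertices `±a`, `±b`, `±c`. The family consists of the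
inscribed caps of these triangles. -/
def IsOctahedral (P : Set (Set S2)) : Prop :=
  ∃ a b c : S2, sphDist a b = Real.pi / 2 ∧ sphDist b c = Real.pi / 2 ∧
    sphDist c a = Real.pi / 2 ∧
    P = {C | ∃ p q s : S2, (p = a ∨ p = -a) ∧ (q = b ∨ q = -b) ∧ (s = c ∨ s = -c) ∧
      IsInscribedCap C p q s}

/-- A cuboctahedral TS-packing. The side lines of a regular spherical triangle with vertices
`a`, `b`, `c` and side length `arccos (1 / 4)` divide the sphere into the eight triangles with
vertices `±a`, `±b`, `±c`; two of them, with vertices `a`, `b`, `c` and `-a`, `-b`, `-c`, are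
regular, and the other six are isosceles. The family consists of the inscribed caps of the six
isosceles triangles. -/
def IsCuboctahedral (P : Set (Set S2)) : Prop :=
  ∃ a b c : S2, sphDist a b = Real.arccos (1 / 4) ∧ sphDist b c = Real.arccos (1 / 4) ∧
    sphDist c a = Real.arccos (1 / 4) ∧
    P = {C | ∃ p q s : S2, (p = a ∨ p = -a) ∧ (q = b ∨ q = -b) ∧ (s = c ∨ s = -c) ∧
      ¬ (p = a ∧ q = b ∧ s = c) ∧ ¬ (p = -a ∧ q = -b ∧ s = -c) ∧
      IsInscribedCap C p q s}

/-! ### Inner product bounds forced by sign patterns -/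

section SignPatterns

open scoped RealInnerProductSpace

variable {V : Type*} [NormedAddCommGroup V] [InnerProductSpace ℝ V]

/-! A cap of angular radius `r` has its interior off a great circle exactly when its center is at
sine distance at least `s = sin r` from the circle. So a TS-packing amounts to a set of unit normals
`U` and a set of centers with `|⟪u, x⟫| ≥ s` throughout, such that different centers have different
sign patterns on `U`. Identify each center with its antipode: a projective sign pattern then arises
from at most two centers, so 5 caps give three projective patterns and 7 caps give four.

Three projective patterns yield, after changes of sign, three circles `vᵢ` and three points `zᵢ`
such that `vᵢ` cuts off `zᵢ` alone (`IsWideSystem.exists_isolatesEach`). Cauchy-Schwarz for `z₁` and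
`-v₁ + 2v₂ + 2v₃`, added over the rotations, loses all inner products `⟪vᵢ, vⱼ⟫` and leaves `75 s² ≤
27`, so `s ≤ 3/5`. Equality forces all of them to be `-1/5`, the cuboctahedral arrangement.

With a fourth pattern, either some three circles have points in all four antipodal pairs of their
triangles, or the four points form a cyclic chain (`IsWideSystem.meetsAll_of_four`). In the first
case Cauchy-Schwarz with `±v₁ ± v₂ ± v₃`, summed over the four pairs, gives `36 s² ≤ 12`, with
equality only for orthogonal circles; in the second `s² < 1/3` (`IsCyclicChain.sq_lt`).

In the equality cases the three circles already determine where every center lies. The bounds are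
attained by explicit packings, checked through `mem_tsRadii_of_centers`. -/

theorem sq_le_norm_sq_of_le_inner {x w : V} {c : ℝ} (hx : ‖x‖ = 1) (hc : 0 ≤ c)
    (h : c ≤ ⟪w, x⟫) : c ^ 2 ≤ ‖w‖ ^ 2 := by
  have h1 := real_inner_le_norm w x
  rw [hx, mul_one] at h1
  exact pow_le_pow_left₀ hc (h.trans h1) 2

theorem eq_smul_of_le_inner {x w : V} {c : ℝ} (hx : ‖x‖ = 1) (hw : ‖w‖ ^ 2 = c ^ 2)
    (hc : 0 ≤ c) (h : c ≤ ⟪w, x⟫) : w = c • x := by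
  have h1 : ‖w - c • x‖ ^ 2 ≤ 0 := by
    rw [norm_sub_sq_real, inner_smul_right, norm_smul, hx, hw, Real.norm_eq_abs, mul_one, sq_abs]
    nlinarith
  have h2 : ‖w - c • x‖ = 0 := by
    have := sq_nonneg ‖w - c • x‖
    exact pow_eq_zero_iff (two_ne_zero) |>.1 (le_antisymm h1 this)
  exact sub_eq_zero.1 (norm_eq_zero.1 h2)

theorem norm_sq_comb_three {v₁ v₂ v₃ : V} (h₁ : ‖v₁‖ = 1) (h₂ : ‖v₂‖ = 1) (h₃ : ‖v₃‖ = 1)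
    (a b c : ℝ) :
    ‖a • v₁ + b • v₂ + c • v₃‖ ^ 2 =
      a ^ 2 + b ^ 2 + c ^ 2 + 2 * (a * b * ⟪v₁, v₂⟫ + a * c * ⟪v₁, v₃⟫ + b * c * ⟪v₂, v₃⟫) := by
  rw [norm_add_sq_real, norm_add_sq_real]
  simp only [norm_smul, inner_add_left, inner_smul_left, inner_smul_right, h₁, h₂, h₃,
    Real.norm_eq_abs, mul_one, sq_abs, conj_trivial]
  ring

theorem norm_sq_comb_four {v₁ v₂ v₃ w : V} (h₁ : ‖v₁‖ = 1) (h₂ : ‖v₂‖ = 1) (h₃ : ‖v₃‖ = 1)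
    (hw : ‖w‖ = 1) (a b c d : ℝ) :
    ‖a • v₁ + b • v₂ + c • v₃ + d • w‖ ^ 2 =
      a ^ 2 + b ^ 2 + c ^ 2 + d ^ 2 +
        2 * (a * b * ⟪v₁, v₂⟫ + a * c * ⟪v₁, v₃⟫ + b * c * ⟪v₂, v₃⟫ +
          a * d * ⟪v₁, w⟫ + b * d * ⟪v₂, w⟫ + c * d * ⟪v₃, w⟫) := by
  rw [norm_add_sq_real, norm_sq_comb_three h₁ h₂ h₃]
  simp only [norm_smul, inner_add_left, inner_smul_left, inner_smul_right, hw,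
    Real.norm_eq_abs, mul_one, sq_abs, conj_trivial]
  ring

/-- Each `vᵢ` has `zᵢ` on its negative side and the other two points on its positive side, all at
sine distance at least `s`. -/
structure IsolatesEach (s : ℝ) (v₁ v₂ v₃ z₁ z₂ z₃ : V) : Prop where
  h₁₁ : s ≤ -⟪v₁, z₁⟫
  h₁₂ : s ≤ ⟪v₁, z₂⟫
  h₁₃ : s ≤ ⟪v₁, z₃⟫
  h₂₁ : s ≤ ⟪v₂, z₁⟫
  h₂₂ : s ≤ -⟪v₂, z₂⟫
  h₂₃ : s ≤ ⟪v₂, z₃⟫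
  h₃₁ : s ≤ ⟪v₃, z₁⟫
  h₃₂ : s ≤ ⟪v₃, z₂⟫
  h₃₃ : s ≤ -⟪v₃, z₃⟫

theorem IsolatesEach.rotate {s : ℝ} {v₁ v₂ v₃ z₁ z₂ z₃ : V}
    (h : IsolatesEach s v₁ v₂ v₃ z₁ z₂ z₃) : IsolatesEach s v₂ v₃ v₁ z₂ z₃ z₁ :=
  ⟨h.h₂₂, h.h₂₃, h.h₂₁, h.h₃₂, h.h₃₃, h.h₃₁, h.h₁₂, h.h₁₃, h.h₁₁⟩

/-- The weights `-1, 2, 2` are those of the extremal configuration, where `z₁ = (-v₁ + 2v₂ + 2v₃) /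
3`. -/
theorem IsolatesEach.weighted_inner_le {s : ℝ} {v₁ v₂ v₃ z₁ z₂ z₃ : V}
    (h : IsolatesEach s v₁ v₂ v₃ z₁ z₂ z₃) :
    5 * s ≤ ⟪(-1 : ℝ) • v₁ + (2 : ℝ) • v₂ + (2 : ℝ) • v₃, z₁⟫ := by
  simp only [inner_add_left, real_inner_smul_left]
  linarith [h.h₁₁, h.h₂₁, h.h₃₁]

theorem IsolatesEach.sq_le {s : ℝ} {v₁ v₂ v₃ z₁ z₂ z₃ : V} (hs : 0 < s)
    (h : IsolatesEach s v₁ v₂ v₃ z₁ z₂ z₃) (h₁ : ‖v₁‖ = 1) (h₂ : ‖v₂‖ = 1) (h₃ : ‖v₃‖ = 1)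
    (hz₁ : ‖z₁‖ = 1) :
    25 * s ^ 2 ≤ 9 - 4 * ⟪v₁, v₂⟫ - 4 * ⟪v₁, v₃⟫ + 8 * ⟪v₂, v₃⟫ := by
  have := sq_le_norm_sq_of_le_inner hz₁ (by positivity) h.weighted_inner_le
  rw [norm_sq_comb_three h₁ h₂ h₃] at this
  linarith

/-- In the sum of the three rotated inequalities each inner product has coefficient `-4 - 4 + 8 =
0`. -/
theorem IsolatesEach.le {s : ℝ} {v₁ v₂ v₃ z₁ z₂ z₃ : V} (hs : 0 < s)
    (h : IsolatesEach s v₁ v₂ v₃ z₁ z₂ z₃) (h₁ : ‖v₁‖ = 1) (h₂ : ‖v₂‖ = 1) (h₃ : ‖v₃‖ = 1)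
    (hz₁ : ‖z₁‖ = 1) (hz₂ : ‖z₂‖ = 1) (hz₃ : ‖z₃‖ = 1) : s ≤ 3 / 5 := by
  have e₁ := h.sq_le hs h₁ h₂ h₃ hz₁
  have e₂ := h.rotate.sq_le hs h₂ h₃ h₁ hz₂
  have e₃ := h.rotate.rotate.sq_le hs h₃ h₁ h₂ hz₃
  rw [real_inner_comm v₁ v₂, real_inner_comm v₁ v₃] at e₂
  rw [real_inner_comm v₁ v₃, real_inner_comm v₂ v₃] at e₃
  nlinarith

/-- Equality in the sum forces equality in each inequality, so the three inner products coincide and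
`-v₁ + 2v₂ + 2v₃ = 3z₁`. Pairing this with `v₁` bounds the common value above by `-1/5`, pairing
with `v₂` bounds it below. -/
theorem IsolatesEach.inner_eq {s : ℝ} {v₁ v₂ v₃ z₁ z₂ z₃ : V} (hs : s = 3 / 5)
    (h : IsolatesEach s v₁ v₂ v₃ z₁ z₂ z₃) (h₁ : ‖v₁‖ = 1) (h₂ : ‖v₂‖ = 1) (h₃ : ‖v₃‖ = 1)
    (hz₁ : ‖z₁‖ = 1) (hz₂ : ‖z₂‖ = 1) (hz₃ : ‖z₃‖ = 1) :
    ⟪v₁, v₂⟫ = -1 / 5 ∧ ⟪v₂, v₃⟫ = -1 / 5 ∧ ⟪v₃, v₁⟫ = -1 / 5 := by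
  have hs0 : 0 < s := by rw [hs]; norm_num
  have e₁ := h.sq_le hs0 h₁ h₂ h₃ hz₁
  have e₂ := h.rotate.sq_le hs0 h₂ h₃ h₁ hz₂
  have e₃ := h.rotate.rotate.sq_le hs0 h₃ h₁ h₂ hz₃
  rw [real_inner_comm v₁ v₂, real_inner_comm v₁ v₃] at e₂
  rw [real_inner_comm v₁ v₃, real_inner_comm v₂ v₃] at e₃
  have hw : ‖(-1 : ℝ) • v₁ + (2 : ℝ) • v₂ + (2 : ℝ) • v₃‖ ^ 2 = 3 ^ 2 := by
    rw [norm_sq_comb_three h₁ h₂ h₃]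
    subst hs
    linarith
  have hz := eq_smul_of_le_inner hz₁ hw (by norm_num)
    (le_trans (by rw [hs]; norm_num) h.weighted_inner_le)
  have hi := congrArg (fun y => ⟪v₁, y⟫) hz
  simp only [inner_add_right, real_inner_smul_right, real_inner_self_eq_norm_sq, h₁] at hi
  have k₁ := h.h₁₁
  have hi₂ := congrArg (fun y => ⟪v₂, y⟫) hz
  simp only [inner_add_right, real_inner_smul_right, real_inner_self_eq_norm_sq, h₂] at hi₂
  have k₂ := h.h₂₁
  rw [real_inner_comm v₁ v₂] at hi₂
  rw [real_inner_comm v₁ v₃]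
  subst hs
  refine ⟨?_, ?_, ?_⟩ <;> linarith

/-- Sine distances of a point inside the triangle that `IsolatesEach` leaves out. -/
theorem sq_le_of_inside {s : ℝ} {v₁ v₂ v₃ z : V} (hs : 0 < s)
    (h₁ : ‖v₁‖ = 1) (h₂ : ‖v₂‖ = 1) (h₃ : ‖v₃‖ = 1) (hz : ‖z‖ = 1)
    (k₁ : s ≤ ⟪v₁, z⟫) (k₂ : s ≤ ⟪v₂, z⟫) (k₃ : s ≤ ⟪v₃, z⟫) :
    9 * s ^ 2 ≤ 3 + 2 * (⟪v₁, v₂⟫ + ⟪v₁, v₃⟫ + ⟪v₂, v₃⟫) := by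
  have : 3 * s ≤ ⟪(1 : ℝ) • v₁ + (1 : ℝ) • v₂ + (1 : ℝ) • v₃, z⟫ := by
    simp only [inner_add_left, real_inner_smul_left]
    linarith
  have := sq_le_norm_sq_of_le_inner hz (by positivity) this
  rw [norm_sq_comb_three h₁ h₂ h₃] at this
  linarith

/-- Negating one `vᵢ` puts `zᵢ` inside the resulting triangle. In the sum of the four inequalities
the inner products cancel; if `s² = 1/3`, all four are equalities. -/
theorem IsolatesEach.sq_le_of_inside {s : ℝ} {v₁ v₂ v₃ z₁ z₂ z₃ z : V} (hs : 0 < s)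
    (h : IsolatesEach s v₁ v₂ v₃ z₁ z₂ z₃) (h₁ : ‖v₁‖ = 1) (h₂ : ‖v₂‖ = 1) (h₃ : ‖v₃‖ = 1)
    (hz₁ : ‖z₁‖ = 1) (hz₂ : ‖z₂‖ = 1) (hz₃ : ‖z₃‖ = 1) (hz : ‖z‖ = 1)
    (k₁ : s ≤ ⟪v₁, z⟫) (k₂ : s ≤ ⟪v₂, z⟫) (k₃ : s ≤ ⟪v₃, z⟫) :
    s ^ 2 ≤ 1 / 3 ∧
      (s ^ 2 = 1 / 3 → ⟪v₁, v₂⟫ = 0 ∧ ⟪v₂, v₃⟫ = 0 ∧ ⟪v₃, v₁⟫ = 0) := by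
  have n₁ : ‖-v₁‖ = 1 := by rwa [norm_neg]
  have n₂ : ‖-v₂‖ = 1 := by rwa [norm_neg]
  have n₃ : ‖-v₃‖ = 1 := by rwa [norm_neg]
  have e₀ := _root_.sq_le_of_inside hs h₁ h₂ h₃ hz k₁ k₂ k₃
  have e₁ := _root_.sq_le_of_inside hs n₁ h₂ h₃ hz₁
    (by rw [inner_neg_left]; exact h.h₁₁) h.h₂₁ h.h₃₁
  have e₂ := _root_.sq_le_of_inside hs h₁ n₂ h₃ hz₂ h.h₁₂
    (by rw [inner_neg_left]; exact h.h₂₂) h.h₃₂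
  have e₃ := _root_.sq_le_of_inside hs h₁ h₂ n₃ hz₃ h.h₁₃ h.h₂₃
    (by rw [inner_neg_left]; exact h.h₃₃)
  simp only [inner_neg_left, inner_neg_right] at e₁ e₂ e₃
  rw [real_inner_comm v₁ v₃]
  refine ⟨by linarith, fun hs3 => ⟨by linarith, by linarith, by linarith⟩⟩

/-- Four great circles and four caps such that no three of the circles separate the caps
up to antipodes. -/
structure IsCyclicChain (s : ℝ) (v₁ v₂ v₃ w y₁ y₂ y₃ y₄ : V) : Prop where
  h₁₁ : s ≤ -⟪v₁, y₁⟫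
  h₂₁ : s ≤ ⟪v₂, y₁⟫
  h₃₁ : s ≤ ⟪v₃, y₁⟫
  hw₁ : s ≤ ⟪w, y₁⟫
  h₁₂ : s ≤ ⟪v₁, y₂⟫
  h₂₂ : s ≤ -⟪v₂, y₂⟫
  h₃₂ : s ≤ ⟪v₃, y₂⟫
  hw₂ : s ≤ ⟪w, y₂⟫
  h₁₃ : s ≤ ⟪v₁, y₃⟫
  h₂₃ : s ≤ ⟪v₂, y₃⟫
  h₃₃ : s ≤ -⟪v₃, y₃⟫
  hw₃ : s ≤ -⟪w, y₃⟫
  h₁₄ : s ≤ -⟪v₁, y₄⟫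
  h₂₄ : s ≤ ⟪v₂, y₄⟫
  h₃₄ : s ≤ ⟪v₃, y₄⟫
  hw₄ : s ≤ -⟪w, y₄⟫

theorem abs_inner_le_one {x y : V} (hx : ‖x‖ = 1) (hy : ‖y‖ = 1) : |⟪x, y⟫| ≤ 1 := by
  simpa [hx, hy] using abs_real_inner_le_norm x y

theorem IsCyclicChain.sq_lt {s : ℝ} {v₁ v₂ v₃ w y₁ y₂ y₃ y₄ : V} (hs : 0 < s)
    (h : IsCyclicChain s v₁ v₂ v₃ w y₁ y₂ y₃ y₄) (h₁ : ‖v₁‖ = 1) (h₂ : ‖v₂‖ = 1)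
    (h₃ : ‖v₃‖ = 1) (hw : ‖w‖ = 1) (hy₁ : ‖y₁‖ = 1) (hy₂ : ‖y₂‖ = 1) (hy₃ : ‖y₃‖ = 1)
    (hy₄ : ‖y₄‖ = 1) : s ^ 2 < 1 / 3 := by
  have key : ∀ (a b c d : ℝ) (y : V), ‖y‖ = 1 →
      14 * s ≤ a * ⟪v₁, y⟫ + b * ⟪v₂, y⟫ + c * ⟪v₃, y⟫ + d * ⟪w, y⟫ →
      (14 * s) ^ 2 ≤ a ^ 2 + b ^ 2 + c ^ 2 + d ^ 2 +
        2 * (a * b * ⟪v₁, v₂⟫ + a * c * ⟪v₁, v₃⟫ + b * c * ⟪v₂, v₃⟫ +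
          a * d * ⟪v₁, w⟫ + b * d * ⟪v₂, w⟫ + c * d * ⟪v₃, w⟫) := by
    intro a b c d y hy h14
    rw [← norm_sq_comb_four h₁ h₂ h₃ hw]
    refine sq_le_norm_sq_of_le_inner hy (by positivity) ?_
    simpa only [inner_add_left, real_inner_smul_left] using h14
  -- In each row the absolute values of the weights add up to 14 and the squares to 58. In the sum
  -- of the four rows only four inner products survive, each with coefficient `±1` inside the factor
  -- 2, so `784 s² ≤ 232 + 8`, that is, `s² ≤ 15/49 < 1/3`.
  have e₁ := key (-2) 5 2 5 y₁ hy₁ (by linarith [h.h₁₁, h.h₂₁, h.h₃₁, h.hw₁])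
  have e₂ := key 5 (-2) 5 2 y₂ hy₂ (by linarith [h.h₁₂, h.h₂₂, h.h₃₂, h.hw₂])
  have e₃ := key 5 5 (-2) (-2) y₃ hy₃ (by linarith [h.h₁₃, h.h₂₃, h.h₃₃, h.hw₃])
  have e₄ := key (-2) 2 5 (-5) y₄ hy₄ (by linarith [h.h₁₄, h.h₂₄, h.h₃₄, h.hw₄])
  have g₁ := (abs_le.1 (abs_inner_le_one h₁ h₂)).2
  have g₂ := (abs_le.1 (abs_inner_le_one h₁ h₃)).2
  have g₃ := (abs_le.1 (abs_inner_le_one h₂ hw)).2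
  have g₄ := (abs_le.1 (abs_inner_le_one h₃ hw)).1
  linarith

/-- `x` and `y` have different sign patterns on `U`, even up to antipodes. -/
def ProjSeparated (U : Set V) (x y : V) : Prop :=
  (∃ u ∈ U, ⟪u, x⟫ * ⟪u, y⟫ < 0) ∧ ∃ u ∈ U, 0 < ⟪u, x⟫ * ⟪u, y⟫

theorem ProjSeparated.symm {U : Set V} {x y : V} (h : ProjSeparated U x y) :
    ProjSeparated U y x := by
  simpa only [ProjSeparated, mul_comm] using h

theorem ProjSeparated.neg_right {U : Set V} {x y : V} (h : ProjSeparated U x y) :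
    ProjSeparated U x (-y) := by
  obtain ⟨⟨u, hu, h1⟩, w, hw, h2⟩ := h
  refine ⟨⟨w, hw, ?_⟩, u, hu, ?_⟩ <;> rw [inner_neg_right] <;> linarith

theorem ProjSeparated.neg_left {U : Set V} {x y : V} (h : ProjSeparated U x y) :
    ProjSeparated U (-x) y := h.symm.neg_right.symm

/-- A set `U` of unit normals and a set `X` of unit vectors, both closed under negation, such that
the sine distance of a vector of `X` from a great circle given by `U` is at least `s`. -/
structure IsWideSystem (s : ℝ) (U X : Set V) : Prop where
  pos : 0 < s
  normU : ∀ u ∈ U, ‖u‖ = 1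
  normX : ∀ x ∈ X, ‖x‖ = 1
  negU : ∀ u ∈ U, -u ∈ U
  negX : ∀ x ∈ X, -x ∈ X
  wide : ∀ u ∈ U, ∀ x ∈ X, s ≤ ⟪u, x⟫ ∨ s ≤ -⟪u, x⟫

/-! ### Combinatorics of sign patterns up to antipodes -/

section Wide

variable {s : ℝ} {U X : Set V}

theorem IsWideSystem.exists_separating (H : IsWideSystem s U X) {x y : V} (hx : x ∈ X)
    (hy : y ∈ X) (h : ∃ u ∈ U, ⟪u, x⟫ * ⟪u, y⟫ < 0) :
    ∃ u ∈ U, s ≤ ⟪u, x⟫ ∧ s ≤ -⟪u, y⟫ := by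
  obtain ⟨u, hu, huxy⟩ := h
  have hs := H.pos
  rcases H.wide u hu x hx with h1 | h1 <;> rcases H.wide u hu y hy with h2 | h2
  · nlinarith
  · exact ⟨u, hu, h1, h2⟩
  · exact ⟨-u, H.negU u hu, by rwa [inner_neg_left], by rwa [inner_neg_left, neg_neg]⟩
  · nlinarith

theorem IsWideSystem.exists_pos (H : IsWideSystem s U X) {u x : V} (hu : u ∈ U) (hx : x ∈ X) :
    ∃ z ∈ X, (z = x ∨ z = -x) ∧ s ≤ ⟪u, z⟫ := by
  rcases H.wide u hu x hx with h | h
  · exact ⟨x, hx, .inl rfl, h⟩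
  · exact ⟨-x, H.negX x hx, .inr rfl, by rwa [inner_neg_right]⟩

theorem ProjSeparated.of_eq_or_neg {x y z t : V} (h : ProjSeparated U x y)
    (hz : z = x ∨ z = -x) (ht : t = y ∨ t = -y) : ProjSeparated U z t := by
  rcases hz with rfl | rfl <;> rcases ht with rfl | rfl
  · exact h
  · exact h.neg_right
  · exact h.neg_left
  · exact h.neg_left.neg_right

/-- The circle `u₂` separating `x₁` from `x₃` completes a table of signs with rows `+++`, `+-+`,
`+?-`. For either value of the unknown sign, negating suitable rows and columns leaves exactly one
minus in each row and column. -/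
theorem IsWideSystem.exists_isolatesEach_aux (H : IsWideSystem s U X) {x₁ x₂ x₃ u₀ u₁ : V}
    (h₁ : x₁ ∈ X) (h₂ : x₂ ∈ X) (h₃ : x₃ ∈ X) (hu₀ : u₀ ∈ U) (hu₁ : u₁ ∈ U)
    (k₁ : s ≤ ⟪u₀, x₁⟫) (k₂ : s ≤ ⟪u₀, x₂⟫) (k₃ : s ≤ ⟪u₀, x₃⟫)
    (l₁ : s ≤ ⟪u₁, x₁⟫) (l₂ : s ≤ -⟪u₁, x₂⟫) (l₃ : s ≤ ⟪u₁, x₃⟫)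
    (h₁₃ : ProjSeparated U x₁ x₃) :
    ∃ v₁ ∈ U, ∃ v₂ ∈ U, ∃ v₃ ∈ U, ∃ z₁ z₂ z₃ : V, (z₁ = x₁ ∨ z₁ = -x₁) ∧
      (z₂ = x₂ ∨ z₂ = -x₂) ∧ (z₃ = x₃ ∨ z₃ = -x₃) ∧ IsolatesEach s v₁ v₂ v₃ z₁ z₂ z₃ := by
  obtain ⟨u₂, hu₂, m₁, m₃⟩ := H.exists_separating h₁ h₃ h₁₃.1
  rcases H.wide u₂ hu₂ x₂ h₂ with m₂ | m₂
  · refine ⟨-u₀, H.negU _ hu₀, u₂, hu₂, u₁, hu₁, x₁, -x₂, -x₃, .inl rfl, .inr rfl, .inr rfl, ?_⟩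
    constructor <;> simpa only [inner_neg_left, inner_neg_right, neg_neg]
  · refine ⟨-u₁, H.negU _ hu₁, u₂, hu₂, u₀, hu₀, x₁, x₂, -x₃, .inl rfl, .inl rfl, .inr rfl, ?_⟩
    constructor <;> simpa only [inner_neg_left, inner_neg_right, neg_neg]

/-- Antipodes may be chosen with all three points on the positive side of one circle. A circle
separating the first two has the third on the side of one of them, which by symmetry is the first.
-/
theorem IsWideSystem.exists_isolatesEach (H : IsWideSystem s U X) {x₁ x₂ x₃ : V}
    (h₁ : x₁ ∈ X) (h₂ : x₂ ∈ X) (h₃ : x₃ ∈ X) (h₁₂ : ProjSeparated U x₁ x₂)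
    (h₁₃ : ProjSeparated U x₁ x₃) (h₂₃ : ProjSeparated U x₂ x₃) :
    ∃ v₁ ∈ U, ∃ v₂ ∈ U, ∃ v₃ ∈ U, ∃ z₁ z₂ z₃ : V, (z₁ = x₁ ∨ z₁ = -x₁) ∧
      (z₂ = x₂ ∨ z₂ = -x₂) ∧ (z₃ = x₃ ∨ z₃ = -x₃) ∧ IsolatesEach s v₁ v₂ v₃ z₁ z₂ z₃ := by
  obtain ⟨u₀, hu₀, -⟩ := h₁₂.1
  obtain ⟨y₁, hy₁, e₁, k₁⟩ := H.exists_pos hu₀ h₁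
  obtain ⟨y₂, hy₂, e₂, k₂⟩ := H.exists_pos hu₀ h₂
  obtain ⟨y₃, hy₃, e₃, k₃⟩ := H.exists_pos hu₀ h₃
  have tr : ∀ {x y z : V}, y = x ∨ y = -x → z = y ∨ z = -y → z = x ∨ z = -x := by
    rintro x y z (rfl | rfl) (rfl | rfl) <;> simp
  obtain ⟨u₁, hu₁, l₁, l₂⟩ := H.exists_separating hy₁ hy₂ (h₁₂.of_eq_or_neg e₁ e₂).1
  rcases H.wide u₁ hu₁ y₃ hy₃ with l₃ | l₃
  · obtain ⟨v₁, hv₁, v₂, hv₂, v₃, hv₃, z₁, z₂, z₃, f₁, f₂, f₃, hz⟩ :=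
      H.exists_isolatesEach_aux hy₁ hy₂ hy₃ hu₀ hu₁ k₁ k₂ k₃ l₁ l₂ l₃ (h₁₃.of_eq_or_neg e₁ e₃)
    exact ⟨v₁, hv₁, v₂, hv₂, v₃, hv₃, z₁, z₂, z₃, tr e₁ f₁, tr e₂ f₂, tr e₃ f₃, hz⟩
  · obtain ⟨v₂, hv₂, v₁, hv₁, v₃, hv₃, z₂, z₁, z₃, f₂, f₁, f₃, hz⟩ :=
      H.exists_isolatesEach_aux hy₂ hy₁ hy₃ hu₀ (H.negU u₁ hu₁) k₂ k₁ k₃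
        (by rwa [inner_neg_left]) (by rwa [inner_neg_left, neg_neg]) (by rwa [inner_neg_left])
        (h₂₃.of_eq_or_neg e₂ e₃)
    exact ⟨v₁, hv₁, v₂, hv₂, v₃, hv₃, z₁, z₂, z₃, tr e₁ f₁, tr e₂ f₂, tr e₃ f₃,
      ⟨hz.h₂₂, hz.h₂₁, hz.h₂₃, hz.h₁₂, hz.h₁₁, hz.h₁₃, hz.h₃₂, hz.h₃₁, hz.h₃₃⟩⟩

/-- All four antipodal pairs of triangles of three great circles given by `U` are met by `X`. -/
def MeetsAllTriangles (s : ℝ) (U X : Set V) : Prop :=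
  ∃ v₁ ∈ U, ∃ v₂ ∈ U, ∃ v₃ ∈ U, ∃ z₁ ∈ X, ∃ z₂ ∈ X, ∃ z₃ ∈ X, ∃ z ∈ X,
    IsolatesEach s v₁ v₂ v₃ z₁ z₂ z₃ ∧ s ≤ ⟪v₁, z⟫ ∧ s ≤ ⟪v₂, z⟫ ∧ s ≤ ⟪v₃, z⟫

/-- Let `w` separate `z₁` from `z`. If `z₂` and `z₃` are on the same side of `w`, the circles `v₂`,
`v₃`, `±w` isolate `z₂`, `z₃` and one of `z₁`, `z`, and the other one lies inside. If not, the four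
points form a cyclic chain, possibly with `-w` for `w` and `z₁`, `z` exchanged. -/
theorem IsWideSystem.meetsAll_of_same_triangle (H : IsWideSystem s U X)
    {v₁ v₂ v₃ z₁ z₂ z₃ z : V} (hv₁ : v₁ ∈ U) (hv₂ : v₂ ∈ U) (hv₃ : v₃ ∈ U)
    (h₁ : z₁ ∈ X) (h₂ : z₂ ∈ X) (h₃ : z₃ ∈ X) (hz : z ∈ X)
    (h : IsolatesEach s v₁ v₂ v₃ z₁ z₂ z₃)
    (k₁ : s ≤ -⟪v₁, z⟫) (k₂ : s ≤ ⟪v₂, z⟫) (k₃ : s ≤ ⟪v₃, z⟫) (hsep : ProjSeparated U z₁ z) :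
    s ^ 2 < 1 / 3 ∨ MeetsAllTriangles s U X := by
  obtain ⟨w, hw, m₁, m⟩ := H.exists_separating h₁ hz hsep.1
  have hw' := H.negU w hw
  have nv₁ := H.normU _ hv₁
  have nv₂ := H.normU _ hv₂
  have nv₃ := H.normU _ hv₃
  have nz₁ := H.normX _ h₁
  have nz₂ := H.normX _ h₂
  have nz₃ := H.normX _ h₃
  have nz := H.normX _ hz
  obtain ⟨h₁₁, h₁₂, h₁₃, h₂₁, h₂₂, h₂₃, h₃₁, h₃₂, h₃₃⟩ := h
  rcases H.wide w hw z₂ h₂ with m₂ | m₂ <;> rcases H.wide w hw z₃ h₃ with m₃ | m₃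
  · refine .inr ⟨v₂, hv₂, v₃, hv₃, w, hw, z₂, h₂, z₃, h₃, z, hz, z₁, h₁, ?_, h₂₁, h₃₁, m₁⟩
    constructor <;> assumption
  · refine .inl (IsCyclicChain.sq_lt (v₁ := v₁) (v₂ := v₂) (v₃ := v₃) (w := w) (y₁ := z₁)
      (y₂ := z₂) (y₃ := z₃) (y₄ := z) H.pos ?_ nv₁ nv₂ nv₃ (H.normU _ hw) nz₁ nz₂ nz₃ nz)
    constructor <;> assumption
  · refine .inl (IsCyclicChain.sq_lt (v₁ := v₁) (v₂ := v₂) (v₃ := v₃) (w := -w) (y₁ := z)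
      (y₂ := z₂) (y₃ := z₃) (y₄ := z₁) H.pos ?_ nv₁ nv₂ nv₃ (H.normU _ hw') nz nz₂ nz₃ nz₁)
    constructor <;> simpa only [inner_neg_left, neg_neg]
  · refine .inr ⟨v₂, hv₂, v₃, hv₃, -w, hw', z₂, h₂, z₃, h₃, z₁, h₁, z, hz, ?_, k₂, k₃, ?_⟩
    · constructor <;> simpa only [inner_neg_left, neg_neg]
    · rwa [inner_neg_left]

/-- The sign pattern of `z` is, up to antipodes, that of a given triangle. -/
theorem IsWideSystem.sign_cases (H : IsWideSystem s U X) {v₁ v₂ v₃ x : V} (hv₁ : v₁ ∈ U)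
    (hv₂ : v₂ ∈ U) (hv₃ : v₃ ∈ U) (hx : x ∈ X) :
    ∃ z ∈ X, (z = x ∨ z = -x) ∧
      ((s ≤ ⟪v₁, z⟫ ∧ s ≤ ⟪v₂, z⟫ ∧ s ≤ ⟪v₃, z⟫) ∨
        (s ≤ -⟪v₁, z⟫ ∧ s ≤ ⟪v₂, z⟫ ∧ s ≤ ⟪v₃, z⟫) ∨
        (s ≤ ⟪v₁, z⟫ ∧ s ≤ -⟪v₂, z⟫ ∧ s ≤ ⟪v₃, z⟫) ∨
        (s ≤ ⟪v₁, z⟫ ∧ s ≤ ⟪v₂, z⟫ ∧ s ≤ -⟪v₃, z⟫)) := by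
  have hx' := H.negX x hx
  rcases H.wide v₁ hv₁ x hx with h1 | h1 <;> rcases H.wide v₂ hv₂ x hx with h2 | h2 <;>
    rcases H.wide v₃ hv₃ x hx with h3 | h3
  · exact ⟨x, hx, .inl rfl, .inl ⟨h1, h2, h3⟩⟩
  · exact ⟨x, hx, .inl rfl, .inr (.inr (.inr ⟨h1, h2, h3⟩))⟩
  · exact ⟨x, hx, .inl rfl, .inr (.inr (.inl ⟨h1, h2, h3⟩))⟩
  · refine ⟨-x, hx', .inr rfl, .inr (.inl ?_)⟩
    simpa only [inner_neg_right, neg_neg] using ⟨h1, h2, h3⟩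
  · exact ⟨x, hx, .inl rfl, .inr (.inl ⟨h1, h2, h3⟩)⟩
  · refine ⟨-x, hx', .inr rfl, .inr (.inr (.inl ?_))⟩
    simpa only [inner_neg_right, neg_neg] using ⟨h1, h2, h3⟩
  · refine ⟨-x, hx', .inr rfl, .inr (.inr (.inr ?_))⟩
    simpa only [inner_neg_right, neg_neg] using ⟨h1, h2, h3⟩
  · refine ⟨-x, hx', .inr rfl, .inl ?_⟩
    simpa only [inner_neg_right, neg_neg] using ⟨h1, h2, h3⟩

theorem IsWideSystem.meetsAll_of_four (H : IsWideSystem s U X) {x₁ x₂ x₃ x₄ : V}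
    (h₁ : x₁ ∈ X) (h₂ : x₂ ∈ X) (h₃ : x₃ ∈ X) (h₄ : x₄ ∈ X) (h₁₂ : ProjSeparated U x₁ x₂)
    (h₁₃ : ProjSeparated U x₁ x₃) (h₂₃ : ProjSeparated U x₂ x₃) (h₁₄ : ProjSeparated U x₁ x₄)
    (h₂₄ : ProjSeparated U x₂ x₄) (h₃₄ : ProjSeparated U x₃ x₄) :
    s ^ 2 < 1 / 3 ∨ MeetsAllTriangles s U X := by
  obtain ⟨v₁, hv₁, v₂, hv₂, v₃, hv₃, z₁, z₂, z₃, e₁, e₂, e₃, h⟩ :=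
    H.exists_isolatesEach h₁ h₂ h₃ h₁₂ h₁₃ h₂₃
  have mem : ∀ {x z : V}, x ∈ X → z = x ∨ z = -x → z ∈ X := by
    rintro x z hx (rfl | rfl)
    exacts [hx, H.negX _ hx]
  have hz₁ := mem h₁ e₁
  have hz₂ := mem h₂ e₂
  have hz₃ := mem h₃ e₃
  obtain ⟨z, hz, e, ⟨k₁, k₂, k₃⟩ | ⟨k₁, k₂, k₃⟩ | ⟨k₁, k₂, k₃⟩ | ⟨k₁, k₂, k₃⟩⟩ :=
    H.sign_cases hv₁ hv₂ hv₃ h₄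
  · exact .inr ⟨v₁, hv₁, v₂, hv₂, v₃, hv₃, z₁, hz₁, z₂, hz₂, z₃, hz₃, z, hz, h, k₁, k₂, k₃⟩
  · exact H.meetsAll_of_same_triangle hv₁ hv₂ hv₃ hz₁ hz₂ hz₃ hz h k₁ k₂ k₃
      (h₁₄.of_eq_or_neg e₁ e)
  · exact H.meetsAll_of_same_triangle hv₂ hv₃ hv₁ hz₂ hz₃ hz₁ hz h.rotate k₂ k₃ k₁
      (h₂₄.of_eq_or_neg e₂ e)
  · exact H.meetsAll_of_same_triangle hv₃ hv₁ hv₂ hz₃ hz₁ hz₂ hz h.rotate.rotate k₃ k₁ k₂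
      (h₃₄.of_eq_or_neg e₃ e)

-- Points in one fiber of `f` have equal or opposite sign patterns. Equal ones are excluded by
-- `hsep`, so a fiber has at most one point on each side of `u₀`.
open Classical in
theorem IsWideSystem.exists_projSeparated (H : IsWideSystem s U X) (T : Finset V)
    (hT : ∀ x ∈ T, x ∈ X) (hsep : ∀ x ∈ T, ∀ y ∈ T, x ≠ y → ∃ u ∈ U, ⟪u, x⟫ * ⟪u, y⟫ < 0)
    {u₀ : V} (hu₀ : u₀ ∈ U) :
    ∃ f : V → Set V, T.card ≤ 2 * (T.image f).card ∧
      ∀ x ∈ T, ∀ y ∈ T, f x ≠ f y → ProjSeparated U x y := by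
  have hne : ∀ u ∈ U, ∀ x ∈ T, ⟪u, x⟫ ≠ 0 := by
    intro u hu x hx h0
    have := H.pos
    rcases H.wide u hu x (hT x hx) with h | h <;> rw [h0] at h <;> linarith
  -- The sign pattern normalized to be positive at `u₀`, hence invariant under `x ↦ -x`.
  let f : V → Set V := fun x => {u | u ∈ U ∧ 0 < ⟪u₀, x⟫ * ⟪u, x⟫}
  have hsame : ∀ x ∈ T, ∀ y ∈ T, f x = f y → x ≠ y → ¬ 0 < ⟪u₀, x⟫ * ⟪u₀, y⟫ := by
    intro x hx y hy hf hxy h0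
    obtain ⟨u, hu, hlt⟩ := hsep x hx y hy hxy
    have hiff : (0 < ⟪u₀, x⟫ * ⟪u, x⟫) ↔ (0 < ⟪u₀, y⟫ * ⟪u, y⟫) := by
      have := Set.ext_iff.1 hf u
      simpa [f, hu] using this
    have a1 := hne u hu x hx
    have a2 := hne u hu y hy
    have b1 := mul_ne_zero (hne u₀ hu₀ x hx) a1
    have b2 := mul_ne_zero (hne u₀ hu₀ y hy) a2
    have h3 : (⟪u₀, x⟫ * ⟪u, x⟫) * (⟪u₀, y⟫ * ⟪u, y⟫) < 0 := by
      have := mul_neg_of_pos_of_neg h0 hlt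
      linarith
    rcases b1.lt_or_gt with c | c <;> rcases b2.lt_or_gt with d | d
    · nlinarith
    · exact absurd (hiff.2 d) (by linarith)
    · exact absurd (hiff.1 c) (by linarith)
    · nlinarith
  refine ⟨f, Finset.card_le_mul_card_image T 2 ?_, ?_⟩
  · intro a _
    by_contra! hcard
    obtain ⟨x, y, z, hx, hy, hz, hxy, hxz, hyz⟩ := Finset.two_lt_card_iff.1 hcard
    simp only [Finset.mem_filter] at hx hy hz
    have p1 := hsame x hx.1 y hy.1 (hx.2.trans hy.2.symm) hxy
    have p2 := hsame x hx.1 z hz.1 (hx.2.trans hz.2.symm) hxz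
    have p3 := hsame y hy.1 z hz.1 (hy.2.trans hz.2.symm) hyz
    have q1 := hne u₀ hu₀ x hx.1
    have q2 := hne u₀ hu₀ y hy.1
    have q3 := hne u₀ hu₀ z hz.1
    simp only [mul_pos_iff, not_or, not_and, not_lt] at p1 p2 p3
    grind
  · intro x hx y hy hf
    have : ∃ u ∈ U, (⟪u₀, x⟫ * ⟪u, x⟫) * (⟪u₀, y⟫ * ⟪u, y⟫) < 0 := by
      by_contra! hc
      apply hf
      ext u
      simp only [f, Set.mem_ofPred_eq, and_congr_right_iff]
      intro hu
      have hc := hc u hu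
      have b1 := mul_ne_zero (hne u₀ hu₀ x hx) (hne u hu x hx)
      have b2 := mul_ne_zero (hne u₀ hu₀ y hy) (hne u hu y hy)
      constructor <;> intro h <;> by_contra h'
      · have := lt_of_le_of_ne (not_lt.1 h') b2; nlinarith
      · have := lt_of_le_of_ne (not_lt.1 h') b1; nlinarith
    obtain ⟨u, hu, hlt⟩ := this
    have h' : (⟪u₀, x⟫ * ⟪u₀, y⟫) * (⟪u, x⟫ * ⟪u, y⟫) < 0 := by linarith
    rcases mul_neg_iff.1 h' with ⟨c, d⟩ | ⟨c, d⟩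
    · exact ⟨⟨u, hu, d⟩, u₀, hu₀, c⟩
    · exact ⟨⟨u₀, hu₀, c⟩, u, hu, d⟩

theorem IsWideSystem.exists_isolatesEach_of_five_le_card (H : IsWideSystem s U X) (T : Finset V)
    (hT : ∀ x ∈ T, x ∈ X) (hsep : ∀ x ∈ T, ∀ y ∈ T, x ≠ y → ∃ u ∈ U, ⟪u, x⟫ * ⟪u, y⟫ < 0)
    (hcard : 5 ≤ T.card) :
    ∃ v₁ ∈ U, ∃ v₂ ∈ U, ∃ v₃ ∈ U, ∃ z₁ ∈ X, ∃ z₂ ∈ X, ∃ z₃ ∈ X,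
      IsolatesEach s v₁ v₂ v₃ z₁ z₂ z₃ := by
  classical
  obtain ⟨x, hx, y, hy, hxy⟩ := Finset.one_lt_card.1 (show 1 < T.card by omega)
  obtain ⟨u₀, hu₀, -⟩ := hsep x hx y hy hxy
  obtain ⟨f, hf, hP⟩ := H.exists_projSeparated T hT hsep hu₀
  obtain ⟨_, m₁, _, m₂, _, m₃, n₁₂, n₁₃, n₂₃⟩ :=
    Finset.two_lt_card.1 (show 2 < (T.image f).card by grind)
  obtain ⟨x₁, h₁, rfl⟩ := Finset.mem_image.1 m₁
  obtain ⟨x₂, h₂, rfl⟩ := Finset.mem_image.1 m₂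
  obtain ⟨x₃, h₃, rfl⟩ := Finset.mem_image.1 m₃
  obtain ⟨v₁, hv₁, v₂, hv₂, v₃, hv₃, z₁, z₂, z₃, e₁, e₂, e₃, h⟩ :=
    H.exists_isolatesEach (hT _ h₁) (hT _ h₂) (hT _ h₃) (hP _ h₁ _ h₂ n₁₂) (hP _ h₁ _ h₃ n₁₃)
      (hP _ h₂ _ h₃ n₂₃)
  have mem : ∀ {x z : V}, x ∈ X → z = x ∨ z = -x → z ∈ X := by
    rintro x z hx (rfl | rfl)
    exacts [hx, H.negX _ hx]
  exact ⟨v₁, hv₁, v₂, hv₂, v₃, hv₃, z₁, mem (hT _ h₁) e₁, z₂, mem (hT _ h₂) e₂, z₃,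
    mem (hT _ h₃) e₃, h⟩

theorem IsWideSystem.meetsAll_of_seven_le_card (H : IsWideSystem s U X) (T : Finset V)
    (hT : ∀ x ∈ T, x ∈ X) (hsep : ∀ x ∈ T, ∀ y ∈ T, x ≠ y → ∃ u ∈ U, ⟪u, x⟫ * ⟪u, y⟫ < 0)
    (hcard : 7 ≤ T.card) : s ^ 2 < 1 / 3 ∨ MeetsAllTriangles s U X := by
  classical
  obtain ⟨x, hx, y, hy, hxy⟩ := Finset.one_lt_card.1 (show 1 < T.card by omega)
  obtain ⟨u₀, hu₀, -⟩ := hsep x hx y hy hxy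
  obtain ⟨f, hf, hP⟩ := H.exists_projSeparated T hT hsep hu₀
  obtain ⟨_, m₁, _, m₂, _, m₃, _, m₄, n₁₂, n₁₃, n₁₄, n₂₃, n₂₄, n₃₄⟩ :=
    Finset.three_lt_card.1 (show 3 < (T.image f).card by grind)
  obtain ⟨x₁, h₁, rfl⟩ := Finset.mem_image.1 m₁
  obtain ⟨x₂, h₂, rfl⟩ := Finset.mem_image.1 m₂
  obtain ⟨x₃, h₃, rfl⟩ := Finset.mem_image.1 m₃
  obtain ⟨x₄, h₄, rfl⟩ := Finset.mem_image.1 m₄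
  exact H.meetsAll_of_four (hT _ h₁) (hT _ h₂) (hT _ h₃) (hT _ h₄) (hP _ h₁ _ h₂ n₁₂)
    (hP _ h₁ _ h₃ n₁₃) (hP _ h₂ _ h₃ n₂₃) (hP _ h₁ _ h₄ n₁₄) (hP _ h₂ _ h₄ n₂₄)
    (hP _ h₃ _ h₄ n₃₄)

end Wide

end SignPatterns

/-! ### Caps, great circles and inscribed caps in terms of inner products -/

section Caps

open scoped RealInnerProductSpace

local notation "E³" => EuclideanSpace ℝ (Fin 3)

theorem norm_S2 (x : S2) : ‖(x : E³)‖ = 1 := norm_eq_of_mem_sphere x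

theorem inner_self_S2 (x : S2) : ⟪(x : E³), x⟫ = 1 := by
  rw [real_inner_self_eq_norm_sq, norm_S2, one_pow]

theorem sphDist_eq_arccos (x y : S2) : sphDist x y = Real.arccos ⟪(x : E³), y⟫ := by
  simp [sphDist, InnerProductGeometry.angle]

theorem cos_sphDist (x y : S2) : Real.cos (sphDist x y) = ⟪(x : E³), y⟫ := by
  simp [sphDist, InnerProductGeometry.cos_angle]

theorem mem_cap_iff {x y : S2} {r : ℝ} (h0 : 0 ≤ r) (h1 : r ≤ Real.pi / 2) :
    y ∈ cap x r ↔ Real.cos r ≤ ⟪(x : E³), y⟫ := by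
  rw [← cos_sphDist]
  exact (Real.strictAntiOn_cos.le_iff_ge ⟨h0, by linarith [Real.pi_pos]⟩
    ⟨InnerProductGeometry.angle_nonneg _ _, InnerProductGeometry.angle_le_pi _ _⟩).symm

theorem self_mem_cap (x : S2) {r : ℝ} (h0 : 0 ≤ r) (h1 : r ≤ Real.pi / 2) : x ∈ cap x r := by
  rw [mem_cap_iff h0 h1, inner_self_S2]
  exact Real.cos_le_one r

/-- Triangle inequality for angles: the center is within `π / 2 - r` of the pole `v`. -/
theorem cap_subset_hemisphere {x v : S2} {r : ℝ} (h0 : 0 ≤ r) (h1 : r ≤ Real.pi / 2)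
    (h : Real.sin r ≤ ⟪(v : E³), x⟫) : cap x r ⊆ hemisphere v := by
  intro y hy
  have hvx : sphDist v x ≤ Real.pi / 2 - r := by
    rw [sphDist_eq_arccos, Real.arccos_eq_pi_div_two_sub_arcsin]
    have : r ≤ Real.arcsin ⟪(v : E³), x⟫ := by
      rw [← Real.arcsin_sin (by linarith [Real.pi_pos]) h1]
      exact Real.monotone_arcsin h
    linarith
  have hxy : sphDist x y ≤ r := hy
  have hvy : sphDist v y ≤ Real.pi / 2 := by
    have := InnerProductGeometry.angle_le_angle_add_angle (v : E³) x y
    unfold sphDist at *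
    linarith
  change 0 ≤ ⟪(v : E³), y⟫
  rw [← cos_sphDist]
  exact Real.cos_nonneg_of_neg_pi_div_two_le_of_le
    (by linarith [Real.pi_pos, InnerProductGeometry.angle_nonneg (v : E³) y,
      show sphDist v y = InnerProductGeometry.angle (v : E³) y from rfl]) hvy

theorem greatCircle_neg (u : S2) : greatCircle (-u) = greatCircle u := by
  ext y
  simp [greatCircle]

/-- Moving from a point of the circle along the great circle towards `-v` leaves the hemisphere at
once. -/
theorem disjoint_greatCircle_interior_of_subset {C : Set S2} {v : S2} (h : C ⊆ hemisphere v) :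
    Disjoint (greatCircle v) (interior C) := by
  rw [Set.disjoint_left]
  intro y hy hyC
  have hvy : ⟪(v : E³), y⟫ = 0 := hy
  have hmem : ∀ t : ℝ, Real.cos t • (y : E³) - Real.sin t • (v : E³) ∈
      Metric.sphere (0 : E³) 1 := by
    intro t
    rw [mem_sphere_zero_iff_norm, ← sq_eq_sq₀ (norm_nonneg _) zero_le_one, norm_sub_sq_real]
    simp only [norm_smul, real_inner_smul_left, real_inner_smul_right, norm_S2,
      real_inner_comm (v : E³) (y : E³), hvy, Real.norm_eq_abs, mul_one, sq_abs]
    linarith [Real.sin_sq_add_cos_sq t]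
  let g : ℝ → S2 := fun t => ⟨_, hmem t⟩
  have hg : Continuous g := by
    refine Continuous.subtype_mk ?_ _
    fun_prop
  have hg0 : g 0 = y := by
    ext1
    simp [g]
  have hev : ∀ᶠ t in nhds (0 : ℝ), g t ∈ interior C :=
    hg.continuousAt.eventually (by rw [hg0]; exact isOpen_interior.mem_nhds hyC)
  obtain ⟨ε, hε, hball⟩ := Metric.eventually_nhds_iff.1 hev
  have hπ := Real.pi_pos
  set t := min (ε / 2) (Real.pi / 2) with ht
  have ht0 : 0 < t := lt_min (by linarith) (by linarith)
  have htε : t < ε := (min_le_left _ _).trans_lt (by linarith)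
  have htπ : t < Real.pi := (min_le_right _ _).trans_lt (by linarith)
  have hgt := h (interior_subset (hball (y := t) (by simpa [abs_of_pos ht0] using htε)))
  have hgt' : 0 ≤ ⟪(v : E³), Real.cos t • (y : E³) - Real.sin t • (v : E³)⟫ := hgt
  rw [inner_sub_right, real_inner_smul_right, real_inner_smul_right, hvy, inner_self_S2] at hgt'
  linarith [Real.sin_pos_of_pos_of_lt_pi ht0 htπ]

/-- Otherwise the normalized projection of `x` to the plane of the circle has inner product `√(1 -
c²) > cos r` with `x`, so it is a point of the circle interior to the cap. -/
theorem sin_le_abs_inner_of_disjoint {u x : S2} {r : ℝ} (h0 : 0 < r) (h1 : r ≤ Real.pi / 2)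
    (h : Disjoint (greatCircle u) (interior (cap x r))) :
    Real.sin r ≤ |⟪(u : E³), x⟫| := by
  by_contra! hlt
  set c := ⟪(u : E³), x⟫ with hc
  have hcos : 0 ≤ Real.cos r :=
    Real.cos_nonneg_of_neg_pi_div_two_le_of_le (by linarith) h1
  have hsq : Real.cos r ^ 2 < 1 - c ^ 2 := by
    have : c ^ 2 < Real.sin r ^ 2 := by
      rw [← sq_abs]
      exact pow_lt_pow_left₀ hlt (abs_nonneg _) two_ne_zero
    linarith [Real.sin_sq_add_cos_sq r]
  set d := √(1 - c ^ 2) with hd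
  have hdcos : Real.cos r < d := Real.lt_sqrt_of_sq_lt hsq
  have hdpos : 0 < d := hcos.trans_lt hdcos
  have hd2 : d ^ 2 = 1 - c ^ 2 := Real.sq_sqrt (by nlinarith [sq_nonneg (Real.cos r)])
  have hn : ‖(x : E³) - c • (u : E³)‖ ^ 2 = d ^ 2 := by
    rw [norm_sub_sq_real, norm_smul, real_inner_smul_right, real_inner_comm, ← hc, norm_S2,
      norm_S2, hd2, Real.norm_eq_abs, mul_one, sq_abs]
    ring
  have hn' : ‖(x : E³) - c • (u : E³)‖ = d := (sq_eq_sq₀ (norm_nonneg _) hdpos.le).1 hn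
  let y : S2 := ⟨d⁻¹ • ((x : E³) - c • (u : E³)), by
    rw [mem_sphere_zero_iff_norm, norm_smul, hn', norm_inv, Real.norm_of_nonneg hdpos.le,
      inv_mul_cancel₀ hdpos.ne']⟩
  have hy : (y : E³) = d⁻¹ • ((x : E³) - c • (u : E³)) := rfl
  have huy : y ∈ greatCircle u := by
    change ⟪(u : E³), (y : E³)⟫ = 0
    rw [hy, real_inner_smul_right, inner_sub_right, real_inner_smul_right, inner_self_S2, ← hc]
    ring
  have hxy : ⟪(x : E³), y⟫ = d := by
    rw [hy, real_inner_smul_right, inner_sub_right, real_inner_smul_right, inner_self_S2,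
      real_inner_comm, ← hc]
    field_simp
    linarith
  have hopen : IsOpen {z : S2 | Real.cos r < ⟪(x : E³), z⟫} :=
    isOpen_lt continuous_const (by fun_prop)
  have hsub : {z : S2 | Real.cos r < ⟪(x : E³), z⟫} ⊆ cap x r := fun z hz =>
    (mem_cap_iff h0.le h1).2 (le_of_lt hz)
  refine Set.disjoint_left.1 h huy (interior_maximal hsub hopen ?_)
  change Real.cos r < ⟪(x : E³), y⟫
  rwa [hxy]

/-- `pᵢ` are, up to positive factors, the dual basis of `vᵢ`: the triangle with vertices `pᵢ` is
the intersection of the hemispheres with poles `vᵢ`. -/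
structure IsDualTriple (v₁ v₂ v₃ p₁ p₂ p₃ : S2) : Prop where
  h₁₁ : 0 < ⟪(v₁ : E³), p₁⟫
  h₁₂ : ⟪(v₁ : E³), p₂⟫ = 0
  h₁₃ : ⟪(v₁ : E³), p₃⟫ = 0
  h₂₁ : ⟪(v₂ : E³), p₁⟫ = 0
  h₂₂ : 0 < ⟪(v₂ : E³), p₂⟫
  h₂₃ : ⟪(v₂ : E³), p₃⟫ = 0
  h₃₁ : ⟪(v₃ : E³), p₁⟫ = 0
  h₃₂ : ⟪(v₃ : E³), p₂⟫ = 0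
  h₃₃ : 0 < ⟪(v₃ : E³), p₃⟫

variable {v₁ v₂ v₃ p₁ p₂ p₃ : S2}

theorem IsDualTriple.rotate (h : IsDualTriple v₁ v₂ v₃ p₁ p₂ p₃) :
    IsDualTriple v₂ v₃ v₁ p₂ p₃ p₁ :=
  ⟨h.h₂₂, h.h₂₃, h.h₂₁, h.h₃₂, h.h₃₃, h.h₃₁, h.h₁₂, h.h₁₃, h.h₁₁⟩

theorem IsDualTriple.neg_first (h : IsDualTriple v₁ v₂ v₃ p₁ p₂ p₃) :
    IsDualTriple (-v₁) v₂ v₃ (-p₁) p₂ p₃ := by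
  obtain ⟨h₁₁, h₁₂, h₁₃, h₂₁, h₂₂, h₂₃, h₃₁, h₃₂, h₃₃⟩ := h
  constructor <;> simpa

/-- The difference of the two sides is orthogonal to `v₁`, `v₂`, `v₃`, which form a basis. -/
theorem IsDualTriple.eq_sum (h : IsDualTriple v₁ v₂ v₃ p₁ p₂ p₃) (y : E³) :
    y = (⟪(v₁ : E³), y⟫ / ⟪(v₁ : E³), p₁⟫) • (p₁ : E³) +
      (⟪(v₂ : E³), y⟫ / ⟪(v₂ : E³), p₂⟫) • (p₂ : E³) +
      (⟪(v₃ : E³), y⟫ / ⟪(v₃ : E³), p₃⟫) • (p₃ : E³) := by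
  obtain ⟨h₁₁, h₁₂, h₁₃, h₂₁, h₂₂, h₂₃, h₃₁, h₃₂, h₃₃⟩ := h
  have hli : LinearIndependent ℝ ![(v₁ : E³), v₂, v₃] := by
    rw [Fintype.linearIndependent_iff]
    intro g hg
    simp only [Fin.sum_univ_three, Matrix.cons_val_zero, Matrix.cons_val_one,
      Matrix.cons_val] at hg
    have e := fun p : S2 => congrArg (fun z => ⟪z, (p : E³)⟫) hg
    simp only [inner_add_left, real_inner_smul_left, inner_zero_left] at e
    have e₁ := e p₁
    have e₂ := e p₂
    have e₃ := e p₃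
    simp only [h₁₂, h₁₃, h₂₁, h₂₃, h₃₁, h₃₂, mul_zero, add_zero, zero_add, mul_eq_zero, h₁₁.ne',
      h₂₂.ne', h₃₃.ne', or_false] at e₁ e₂ e₃
    intro i
    fin_cases i <;> assumption
  have hspan := hli.span_eq_top_of_card_eq_finrank (by simp)
  rw [← sub_eq_zero]
  set z := y - ((⟪(v₁ : E³), y⟫ / ⟪(v₁ : E³), p₁⟫) • (p₁ : E³) +
      (⟪(v₂ : E³), y⟫ / ⟪(v₂ : E³), p₂⟫) • (p₂ : E³) +
      (⟪(v₃ : E³), y⟫ / ⟪(v₃ : E³), p₃⟫) • (p₃ : E³)) with hz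
  have k₁ : ⟪(v₁ : E³), z⟫ = 0 := by
    simp only [hz, inner_sub_right, inner_add_right, real_inner_smul_right, h₁₂, h₁₃]
    field_simp
    ring
  have k₂ : ⟪(v₂ : E³), z⟫ = 0 := by
    simp only [hz, inner_sub_right, inner_add_right, real_inner_smul_right, h₂₁, h₂₃]
    field_simp
    ring
  have k₃ : ⟪(v₃ : E³), z⟫ = 0 := by
    simp only [hz, inner_sub_right, inner_add_right, real_inner_smul_right, h₃₁, h₃₂]
    field_simp
    ring
  have hmem : z ∈ Submodule.span ℝ (Set.range ![(v₁ : E³), v₂, v₃]) := by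
    rw [hspan]
    trivial
  obtain ⟨c, hc⟩ := (Submodule.mem_span_range_iff_exists_fun ℝ).1 hmem
  simp only [Fin.sum_univ_three, Matrix.cons_val_zero, Matrix.cons_val_one,
    Matrix.cons_val] at hc
  rw [← inner_self_eq_zero (𝕜 := ℝ)]
  nth_rw 1 [← hc]
  simp only [inner_add_left, real_inner_smul_left, k₁, k₂, k₃, mul_zero, add_zero]

/-- The touching point is the normalized projection of the center to the plane orthogonal to `v₁`;
it stays on the nonnegative sides of `v₂` and `v₃` because `⟪vᵢ, v₁⟫ ≤ 1`. -/
theorem IsDualTriple.cap_inter_sphArc (h : IsDualTriple v₁ v₂ v₃ p₁ p₂ p₃) {x : S2} {r : ℝ}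
    (h0 : 0 < r) (h1 : r < Real.pi / 2) (k₁ : ⟪(v₁ : E³), x⟫ = Real.sin r)
    (k₂ : ⟪(v₂ : E³), x⟫ = Real.sin r) (k₃ : ⟪(v₃ : E³), x⟫ = Real.sin r) :
    (cap x r ∩ sphArc p₂ p₃).Nonempty := by
  have hcos : 0 < Real.cos r := Real.cos_pos_of_mem_Ioo ⟨by linarith, h1⟩
  have hsin : 0 < Real.sin r := Real.sin_pos_of_pos_of_lt_pi h0 (by linarith)
  have hcs := Real.sin_sq_add_cos_sq r
  let y : S2 := ⟨(Real.cos r)⁻¹ • ((x : E³) - Real.sin r • (v₁ : E³)), by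
    rw [mem_sphere_zero_iff_norm, ← sq_eq_sq₀ (norm_nonneg _) zero_le_one, norm_smul, mul_pow,
      norm_sub_sq_real, norm_smul, real_inner_smul_right, real_inner_comm, k₁, norm_S2, norm_S2,
      norm_inv, Real.norm_of_nonneg hcos.le, Real.norm_of_nonneg hsin.le]
    field_simp
    linarith⟩
  have hy : (y : E³) = (Real.cos r)⁻¹ • ((x : E³) - Real.sin r • (v₁ : E³)) := rfl
  have hvy : ∀ v : S2, ⟪(v : E³), y⟫ =
      (Real.cos r)⁻¹ * (⟪(v : E³), x⟫ - Real.sin r * ⟪(v : E³), v₁⟫) := fun v => by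
    rw [hy, real_inner_smul_right, inner_sub_right, real_inner_smul_right]
  have hnn : ∀ v : S2, ⟪(v : E³), x⟫ = Real.sin r → 0 ≤ ⟪(v : E³), y⟫ := fun v hv => by
    rw [hvy, hv]
    have := (abs_le.1 (abs_inner_le_one (norm_S2 v) (norm_S2 v₁))).2
    have : 0 ≤ Real.sin r - Real.sin r * ⟪(v : E³), v₁⟫ := by nlinarith
    positivity
  refine ⟨y, ?_, ⟪(v₂ : E³), y⟫ / ⟪(v₂ : E³), p₂⟫, ⟪(v₃ : E³), y⟫ / ⟪(v₃ : E³), p₃⟫,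
    div_nonneg (hnn _ k₂) h.h₂₂.le, div_nonneg (hnn _ k₃) h.h₃₃.le, ?_⟩
  · rw [mem_cap_iff h0.le h1.le, hvy, inner_self_S2, real_inner_comm, k₁]
    apply le_of_eq
    field_simp
    linarith
  · have hv₁ : ⟪(v₁ : E³), y⟫ = 0 := by
      rw [hvy, k₁, inner_self_S2]
      ring
    have := h.eq_sum y
    rwa [hv₁, zero_div, zero_smul, zero_add] at this

theorem IsDualTriple.isInscribedCap (h : IsDualTriple v₁ v₂ v₃ p₁ p₂ p₃) {x : S2} {r : ℝ}
    (h0 : 0 < r) (h1 : r < Real.pi / 2) (k₁ : ⟪(v₁ : E³), x⟫ = Real.sin r)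
    (k₂ : ⟪(v₂ : E³), x⟫ = Real.sin r) (k₃ : ⟪(v₃ : E³), x⟫ = Real.sin r) :
    IsInscribedCap (cap x r) p₁ p₂ p₃ := by
  refine ⟨⟨r, h0, h1.le, x, rfl⟩, fun y hy => ?_,
    h.rotate.rotate.cap_inter_sphArc h0 h1 k₃ k₁ k₂, h.cap_inter_sphArc h0 h1 k₁ k₂ k₃,
    h.rotate.cap_inter_sphArc h0 h1 k₂ k₃ k₁⟩
  exact ⟨_, _, _, div_nonneg (cap_subset_hemisphere h0.le h1.le k₁.ge hy) h.h₁₁.le,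
    div_nonneg (cap_subset_hemisphere h0.le h1.le k₂.ge hy) h.h₂₂.le,
    div_nonneg (cap_subset_hemisphere h0.le h1.le k₃.ge hy) h.h₃₃.le, h.eq_sum y⟩

theorem IsDualTriple.exists_orient_first (h : IsDualTriple v₁ v₂ v₃ p₁ p₂ p₃) {x : S2} {s : ℝ}
    (hs : 0 < s) (k : |⟪(v₁ : E³), x⟫| = s) :
    ∃ w q : S2, IsDualTriple w v₂ v₃ q p₂ p₃ ∧ (q = p₁ ∨ q = -p₁) ∧ ⟪(w : E³), x⟫ = s ∧
      0 < ⟪(v₁ : E³), x⟫ * ⟪(v₁ : E³), q⟫ := by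
  rcases (abs_eq hs.le).1 k with k | k
  · exact ⟨v₁, p₁, h, .inl rfl, k, by rw [k]; exact mul_pos hs h.h₁₁⟩
  · refine ⟨-v₁, -p₁, h.neg_first, .inr rfl, ?_, ?_⟩
    · rw [coe_neg_sphere, inner_neg_left, k, neg_neg]
    · rw [coe_neg_sphere, inner_neg_right, k, neg_mul_neg]
      exact mul_pos hs h.h₁₁

/-- The sign clauses record which triangle contains the cap; they serve to exclude the two regular
triangles in the cuboctahedral case. -/
theorem IsDualTriple.exists_isInscribedCap (h : IsDualTriple v₁ v₂ v₃ p₁ p₂ p₃) {x : S2} {r : ℝ}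
    (h0 : 0 < r) (h1 : r < Real.pi / 2) (k₁ : |⟪(v₁ : E³), x⟫| = Real.sin r)
    (k₂ : |⟪(v₂ : E³), x⟫| = Real.sin r) (k₃ : |⟪(v₃ : E³), x⟫| = Real.sin r) :
    ∃ q₁ q₂ q₃ : S2, (q₁ = p₁ ∨ q₁ = -p₁) ∧ (q₂ = p₂ ∨ q₂ = -p₂) ∧ (q₃ = p₃ ∨ q₃ = -p₃) ∧
      0 < ⟪(v₁ : E³), x⟫ * ⟪(v₁ : E³), q₁⟫ ∧ 0 < ⟪(v₂ : E³), x⟫ * ⟪(v₂ : E³), q₂⟫ ∧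
      0 < ⟪(v₃ : E³), x⟫ * ⟪(v₃ : E³), q₃⟫ ∧ IsInscribedCap (cap x r) q₁ q₂ q₃ := by
  have hsin : 0 < Real.sin r := Real.sin_pos_of_pos_of_lt_pi h0 (by linarith)
  obtain ⟨w₁, q₁, d₁, e₁, i₁, g₁⟩ := h.exists_orient_first hsin k₁
  obtain ⟨w₂, q₂, d₂, e₂, i₂, g₂⟩ := d₁.rotate.exists_orient_first hsin k₂
  obtain ⟨w₃, q₃, d₃, e₃, i₃, g₃⟩ := d₂.rotate.exists_orient_first hsin k₃
  exact ⟨q₁, q₂, q₃, e₁, e₂, e₃, g₁, g₂, g₃, d₃.rotate.isInscribedCap h0 h1 i₁ i₂ i₃⟩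

theorem IsTSPackingOf.exists_isWideSystem {k : ℕ} (hk : 1 ≤ k) {r : ℝ} {F : Set (Set S2)}
    (h : IsTSPackingOf k r F) :
    0 < r ∧ r ≤ Real.pi / 2 ∧ ∃ (U X : Set E³) (T : Finset E³),
      IsWideSystem (Real.sin r) U X ∧ T.card = k ∧ (∀ x ∈ T, x ∈ X) ∧
      (∀ x ∈ T, ∀ y ∈ T, x ≠ y → ∃ u ∈ U, ⟪u, x⟫ * ⟪u, y⟫ < 0) ∧
      ∀ C ∈ F, ∃ x : S2, (x : E³) ∈ X ∧ C = cap x r := by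
  classical
  obtain ⟨⟨-, hsep⟩, hcard, hrad⟩ := h
  have hne : F.Nonempty := by
    rw [← Set.encard_ne_zero, hcard]
    exact_mod_cast (by omega : k ≠ 0)
  obtain ⟨C₀, hC₀⟩ := hne
  obtain ⟨h0, h1, -⟩ := hrad C₀ hC₀
  have hex : ∀ C : Set S2, ∃ x : S2, C ∈ F → C = cap x r := fun C => by
    by_cases hC : C ∈ F
    · obtain ⟨-, -, x, hx⟩ := hrad C hC
      exact ⟨x, fun _ => hx⟩
    · obtain ⟨-, -, x, hx⟩ := hrad C₀ hC₀
      exact ⟨x, fun h => absurd h hC⟩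
  choose c hc using hex
  have hsin : 0 < Real.sin r := Real.sin_pos_of_pos_of_lt_pi h0 (by linarith [Real.pi_pos])
  have hfin : F.Finite := Set.finite_of_encard_eq_coe hcard
  have hmem : ∀ C ∈ F, c C ∈ C := fun C hC => by
    have := self_mem_cap (c C) h0.le h1
    rwa [← hc C hC] at this
  -- All admissible circles are taken, not only the chosen separating ones; this makes `U` closed
  -- under negation.
  let U : Set E³ := {u | ‖u‖ = 1 ∧ ∀ C ∈ F, Real.sin r ≤ |⟪u, (c C : E³)⟫|}
  let X : Set E³ := {x | ∃ C ∈ F, x = c C ∨ x = -c C}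
  have hinj : Set.InjOn (fun C => (c C : E³)) hfin.toFinset := by
    intro C hC D hD hCD
    rw [hc C (by simpa using hC), hc D (by simpa using hD), Subtype.ext hCD]
  refine ⟨h0, h1, U, X, hfin.toFinset.image fun C => (c C : E³), ?_, ?_, ?_, ?_, ?_⟩
  · refine ⟨hsin, fun u hu => hu.1, ?_, ?_, ?_, ?_⟩
    · rintro x ⟨C, -, rfl | rfl⟩
      · exact norm_S2 _
      · rw [norm_neg, norm_S2]
    · rintro u ⟨hu, hu'⟩
      exact ⟨by rwa [norm_neg], by simpa only [inner_neg_left, abs_neg] using hu'⟩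
    · rintro x ⟨C, hC, rfl | rfl⟩
      · exact ⟨C, hC, .inr rfl⟩
      · exact ⟨C, hC, .inl (neg_neg _)⟩
    · rintro u ⟨-, hu⟩ x ⟨C, hC, rfl | rfl⟩
      · exact le_abs.1 (hu C hC)
      · rw [inner_neg_right, neg_neg]
        exact (le_abs.1 (hu C hC)).symm
  · rw [Finset.card_image_of_injOn hinj]
    have := hfin.encard_eq_coe_toFinset_card
    rw [hcard] at this
    exact_mod_cast this.symm
  · intro x hx
    obtain ⟨C, hC, rfl⟩ := Finset.mem_image.1 hx
    exact ⟨C, by simpa using hC, .inl rfl⟩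
  · intro x hx y hy hxy
    obtain ⟨C, hC, rfl⟩ := Finset.mem_image.1 hx
    obtain ⟨D, hD, rfl⟩ := Finset.mem_image.1 hy
    rw [Set.Finite.mem_toFinset] at hC hD
    obtain ⟨u, hu, hdis⟩ := hsep C hC D hD (by rintro rfl; exact hxy rfl)
    have hw : ∀ B ∈ F, Real.sin r ≤ |⟪(u : E³), (c B : E³)⟫| := fun B hB =>
      sin_le_abs_inner_of_disjoint h0 h1 (by rw [← hc B hB]; exact hdis B hB)
    refine ⟨u, ⟨norm_S2 u, hw⟩, ?_⟩
    have wC := hw C hC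
    have wD := hw D hD
    rcases hu with ⟨a, b⟩ | ⟨a, b⟩
    · have a' : 0 ≤ ⟪(u : E³), (c C : E³)⟫ := a (hmem C hC)
      have b' : 0 ≤ ⟪((-u : S2) : E³), (c D : E³)⟫ := b (hmem D hD)
      rw [coe_neg_sphere, inner_neg_left] at b'
      rw [abs_of_nonneg a'] at wC
      rw [abs_of_nonpos (by linarith)] at wD
      exact mul_neg_of_pos_of_neg (by linarith) (by linarith)
    · have a' : 0 ≤ ⟪((-u : S2) : E³), (c C : E³)⟫ := a (hmem C hC)
      have b' : 0 ≤ ⟪(u : E³), (c D : E³)⟫ := b (hmem D hD)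
      rw [coe_neg_sphere, inner_neg_left] at a'
      rw [abs_of_nonneg b'] at wD
      rw [abs_of_nonpos (by linarith)] at wC
      exact mul_neg_of_neg_of_pos (by linarith) (by linarith)
  · exact fun C hC => ⟨c C, ⟨C, hC, .inl rfl⟩, hc C hC⟩

theorem mem_tsRadii_of_centers {ι : Type*} [Fintype ι] {r : ℝ} (h0 : 0 < r)
    (h1 : r ≤ Real.pi / 2) (x : ι → S2) (W : Set S2)
    (hW : ∀ w ∈ W, ∀ i, Real.sin r ≤ |⟪(w : E³), x i⟫|)
    (hsep : ∀ i j, i ≠ j → ∃ w ∈ W, ⟪(w : E³), x i⟫ * ⟪(w : E³), x j⟫ < 0) {k : ℕ}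
    (hk : k ≤ Fintype.card ι) : r ∈ tsRadii k := by
  have hsin : 0 < Real.sin r := Real.sin_pos_of_pos_of_lt_pi h0 (by linarith [Real.pi_pos])
  have hor : ∀ w ∈ W, ∀ i, cap (x i) r ⊆ hemisphere w ∨ cap (x i) r ⊆ hemisphere (-w) := by
    intro w hw i
    rcases le_abs.1 (hW w hw i) with h | h
    · exact .inl (cap_subset_hemisphere h0.le h1 h)
    · exact .inr (cap_subset_hemisphere h0.le h1 (by rwa [coe_neg_sphere, inner_neg_left]))
  have hpos : ∀ w : S2, ∀ i, cap (x i) r ⊆ hemisphere w → 0 ≤ ⟪(w : E³), x i⟫ :=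
    fun w i h => h (self_mem_cap (x i) h0.le h1)
  have hneg : ∀ w : S2, ∀ i, cap (x i) r ⊆ hemisphere (-w) → ⟪(w : E³), x i⟫ ≤ 0 :=
    fun w i h => by
      have := hpos _ i h
      rw [coe_neg_sphere, inner_neg_left] at this
      linarith
  have hsep' : ∀ i j, i ≠ j → ∃ w ∈ W, Separates w (cap (x i) r) (cap (x j) r) ∧
      cap (x i) r ≠ cap (x j) r := by
    intro i j hij
    obtain ⟨w, hw, hlt⟩ := hsep i j hij
    refine ⟨w, hw, ?_, ?_⟩
    · rcases hor w hw i with a | a <;> rcases hor w hw j with b | b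
      · nlinarith [hpos w i a, hpos w j b]
      · exact .inl ⟨a, b⟩
      · exact .inr ⟨a, b⟩
      · nlinarith [hneg w i a, hneg w j b]
    · intro heq
      rcases hor w hw i with a | a
      · nlinarith [hpos w i a, hpos w j (heq ▸ a)]
      · nlinarith [hneg w i a, hneg w j (heq ▸ a)]
  have hinj : Function.Injective fun i => cap (x i) r := by
    intro i j hij
    by_contra hne
    obtain ⟨w, -, -, h⟩ := hsep' i j hne
    exact h hij
  obtain ⟨S, -, hS⟩ := Finset.exists_subset_card_eq (s := (Finset.univ : Finset ι)) (n := k)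
    (by simpa using hk)
  have hrad : ∀ C ∈ (fun i => cap (x i) r) '' (S : Set ι), IsCapOfRadius r C := by
    rintro _ ⟨i, -, rfl⟩
    exact ⟨h0, h1, x i, rfl⟩
  refine ⟨(fun i => cap (x i) r) '' (S : Set ι), ⟨fun C hC => ⟨r, hrad C hC⟩, ?_⟩, ?_, hrad⟩
  · rintro _ ⟨i, -, rfl⟩ _ ⟨j, -, rfl⟩ hne
    obtain ⟨w, hw, hws, -⟩ := hsep' i j (by rintro rfl; exact hne rfl)
    refine ⟨w, hws, ?_⟩
    rintro _ ⟨l, -, rfl⟩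
    rcases hor w hw l with h | h
    · exact disjoint_greatCircle_interior_of_subset h
    · rw [← greatCircle_neg]
      exact disjoint_greatCircle_interior_of_subset h
  · rw [hinj.encard_image, Set.encard_coe_eq_coe_finsetCard, hS]

end Caps

/-! ### Upper bounds and the equality cases -/

section Extremal

open scoped RealInnerProductSpace

local notation "E³" => EuclideanSpace ℝ (Fin 3)

theorem sin_arctan_three_fourths : Real.sin (Real.arctan (3 / 4)) = 3 / 5 := by
  have h : √(1 + (3 / 4 : ℝ) ^ 2) = 5 / 4 := by
    rw [show (1 + (3 / 4 : ℝ) ^ 2) = (5 / 4) ^ 2 by norm_num]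
    exact Real.sqrt_sq (by norm_num)
  rw [Real.sin_arctan, h]
  norm_num

theorem sin_arcsin_one_div_sqrt_three : Real.sin (Real.arcsin (1 / √3)) = 1 / √3 := by
  have h : (1 : ℝ) ≤ √3 := Real.one_le_sqrt.2 (by norm_num)
  refine Real.sin_arcsin ?_ ((div_le_one (by positivity)).2 h)
  have : 0 < 1 / √3 := by positivity
  linarith

theorem one_div_sqrt_three_sq : (1 / √3 : ℝ) ^ 2 = 1 / 3 := by
  rw [div_pow, Real.sq_sqrt (by norm_num), one_pow]

theorem arcsin_one_div_sqrt_three_mem :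
    0 < Real.arcsin (1 / √3) ∧ Real.arcsin (1 / √3) < Real.pi / 2 := by
  refine ⟨Real.arcsin_pos.2 (by positivity), Real.arcsin_lt_pi_div_two.2 ?_⟩
  have h : (1 : ℝ) < √3 := by
    rw [Real.lt_sqrt] <;> norm_num
  exact (div_lt_one (by positivity)).2 h

theorem arctan_three_fourths_mem :
    0 < Real.arctan (3 / 4) ∧ Real.arctan (3 / 4) < Real.pi / 2 :=
  ⟨Real.arctan_pos.2 (by norm_num), Real.arctan_lt_pi_div_two _⟩

theorem le_of_sin_le_sin {r t : ℝ} (h0 : 0 < r) (h1 : r ≤ Real.pi / 2) (t0 : 0 < t)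
    (t1 : t < Real.pi / 2) (h : Real.sin r ≤ Real.sin t) : r ≤ t :=
  (Real.strictMonoOn_sin.le_iff_le ⟨by linarith, h1⟩ ⟨by linarith, t1.le⟩).1 h

theorem IsTSPackingOf.le_arctan {k : ℕ} (hk : 5 ≤ k) {r : ℝ} {F : Set (Set S2)}
    (h : IsTSPackingOf k r F) : r ≤ Real.arctan (3 / 4) := by
  obtain ⟨h0, h1, U, X, T, H, hT, hTX, hsep, -⟩ := h.exists_isWideSystem (by omega)
  obtain ⟨v₁, hv₁, v₂, hv₂, v₃, hv₃, z₁, hz₁, z₂, hz₂, z₃, hz₃, hI⟩ :=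
    H.exists_isolatesEach_of_five_le_card T hTX hsep (by omega)
  refine le_of_sin_le_sin h0 h1 arctan_three_fourths_mem.1 arctan_three_fourths_mem.2 ?_
  rw [sin_arctan_three_fourths]
  exact hI.le H.pos (H.normU _ hv₁) (H.normU _ hv₂) (H.normU _ hv₃) (H.normX _ hz₁)
    (H.normX _ hz₂) (H.normX _ hz₃)

theorem IsTSPackingOf.le_arcsin {k : ℕ} (hk : 7 ≤ k) {r : ℝ} {F : Set (Set S2)}
    (h : IsTSPackingOf k r F) : r ≤ Real.arcsin (1 / √3) := by
  obtain ⟨h0, h1, U, X, T, H, hT, hTX, hsep, -⟩ := h.exists_isWideSystem (by omega)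
  have hsq : Real.sin r ^ 2 ≤ 1 / 3 := by
    rcases H.meetsAll_of_seven_le_card T hTX hsep (by omega) with hlt | hall
    · exact hlt.le
    · obtain ⟨v₁, hv₁, v₂, hv₂, v₃, hv₃, z₁, hz₁, z₂, hz₂, z₃, hz₃, z, hz, hI, k₁, k₂, k₃⟩ := hall
      exact (hI.sq_le_of_inside H.pos (H.normU _ hv₁) (H.normU _ hv₂) (H.normU _ hv₃)
        (H.normX _ hz₁) (H.normX _ hz₂) (H.normX _ hz₃) (H.normX _ hz) k₁ k₂ k₃).1
  refine le_of_sin_le_sin h0 h1 arcsin_one_div_sqrt_three_mem.1 arcsin_one_div_sqrt_three_mem.2 ?_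
  rw [sin_arcsin_one_div_sqrt_three]
  rw [← one_div_sqrt_three_sq] at hsq
  exact (pow_le_pow_iff_left₀ H.pos.le (by positivity) two_ne_zero).1 hsq

theorem isDualTriple_self {a b c : S2} (h₁₂ : ⟪(a : E³), b⟫ = 0) (h₂₃ : ⟪(b : E³), c⟫ = 0)
    (h₃₁ : ⟪(c : E³), a⟫ = 0) : IsDualTriple a b c a b c := by
  have h₂₁ := h₁₂
  have h₃₂ := h₂₃
  have h₁₃ := h₃₁
  rw [real_inner_comm] at h₂₁ h₃₂ h₁₃
  constructor <;> first | assumption | (rw [inner_self_S2]; exact one_pos)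

theorem IsTSPackingOf.exists_isOctahedral {k : ℕ} (hk : 7 ≤ k) {F : Set (Set S2)}
    (h : IsTSPackingOf k (Real.arcsin (1 / √3)) F) : ∃ P, IsOctahedral P ∧ F ⊆ P := by
  obtain ⟨h0, -, U, X, T, H, hT, hTX, hsep, hF⟩ := h.exists_isWideSystem (by omega)
  have h1 := arcsin_one_div_sqrt_three_mem.2
  have hs2 : Real.sin (Real.arcsin (1 / √3)) ^ 2 = 1 / 3 := by
    rw [sin_arcsin_one_div_sqrt_three, one_div_sqrt_three_sq]
  rcases H.meetsAll_of_seven_le_card T hTX hsep (by omega) with hlt | hall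
  · exact absurd hlt (by rw [hs2]; exact lt_irrefl _)
  obtain ⟨v₁, hv₁, v₂, hv₂, v₃, hv₃, z₁, hz₁, z₂, hz₂, z₃, hz₃, z, hz, hI, k₁, k₂, k₃⟩ := hall
  obtain ⟨g₁₂, g₂₃, g₃₁⟩ := (hI.sq_le_of_inside H.pos (H.normU _ hv₁) (H.normU _ hv₂)
    (H.normU _ hv₃) (H.normX _ hz₁) (H.normX _ hz₂) (H.normX _ hz₃) (H.normX _ hz) k₁ k₂ k₃).2 hs2
  obtain ⟨a, rfl⟩ : ∃ a : S2, (a : E³) = v₁ :=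
    ⟨⟨v₁, mem_sphere_zero_iff_norm.2 (H.normU _ hv₁)⟩, rfl⟩
  obtain ⟨b, rfl⟩ : ∃ b : S2, (b : E³) = v₂ :=
    ⟨⟨v₂, mem_sphere_zero_iff_norm.2 (H.normU _ hv₂)⟩, rfl⟩
  obtain ⟨c, rfl⟩ : ∃ c : S2, (c : E³) = v₃ :=
    ⟨⟨v₃, mem_sphere_zero_iff_norm.2 (H.normU _ hv₃)⟩, rfl⟩
  have hD := isDualTriple_self g₁₂ g₂₃ g₃₁
  refine ⟨_, ⟨a, b, c, ?_, ?_, ?_, rfl⟩, fun C hC => ?_⟩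
  · rw [sphDist_eq_arccos, g₁₂, Real.arccos_zero]
  · rw [sphDist_eq_arccos, g₂₃, Real.arccos_zero]
  · rw [sphDist_eq_arccos, g₃₁, Real.arccos_zero]
  obtain ⟨x, hx, rfl⟩ := hF C hC
  -- Three squares that are each at least `1/3` and add up to 1 must all equal `1/3`.
  have hsum : ⟪(a : E³), x⟫ ^ 2 + ⟪(b : E³), x⟫ ^ 2 + ⟪(c : E³), x⟫ ^ 2 = 1 := by
    have := congrArg (fun y => ‖y‖ ^ 2) (hD.eq_sum x)
    simp only [inner_self_S2, div_one] at this
    rw [norm_sq_comb_three (norm_S2 _) (norm_S2 _) (norm_S2 _), norm_S2, g₁₂, g₂₃,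
      real_inner_comm (c : E³) a, g₃₁] at this
    linarith
  have wide : ∀ u ∈ U, 1 / 3 ≤ ⟪u, (x : E³)⟫ ^ 2 := fun u hu => by
    rw [← hs2, ← sq_abs ⟪u, (x : E³)⟫]
    exact pow_le_pow_left₀ H.pos.le (le_abs.2 (H.wide u hu x hx)) 2
  have wa := wide _ hv₁
  have wb := wide _ hv₂
  have wc := wide _ hv₃
  have habs : ∀ t : ℝ, t ^ 2 = 1 / 3 → |t| = Real.sin (Real.arcsin (1 / √3)) := fun t ht => by
    rw [← sq_eq_sq₀ (abs_nonneg _) H.pos.le, sq_abs, ht, hs2]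
  obtain ⟨p, q, t, hp, hq, ht, -, -, -, hins⟩ := hD.exists_isInscribedCap h0 h1
    (habs ⟪(a : E³), x⟫ (by linarith)) (habs ⟪(b : E³), x⟫ (by linarith))
    (habs ⟪(c : E³), x⟫ (by linarith))
  exact ⟨p, q, t, hp, hq, ht, hins⟩

/-- Three circles of mutual inner product `-1 / 5` are the side lines of a regular triangle of side
length `arccos (1 / 4)`. -/
theorem exists_isDualTriple {v₁ v₂ v₃ : S2} (g₁₂ : ⟪(v₁ : E³), v₂⟫ = -1 / 5)
    (g₂₃ : ⟪(v₂ : E³), v₃⟫ = -1 / 5) (g₃₁ : ⟪(v₃ : E³), v₁⟫ = -1 / 5) :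
    ∃ a b c : S2, IsDualTriple v₁ v₂ v₃ a b c ∧ sphDist a b = Real.arccos (1 / 4) ∧
      sphDist b c = Real.arccos (1 / 4) ∧ sphDist c a = Real.arccos (1 / 4) := by
  have g₂₁ := g₁₂
  have g₃₂ := g₂₃
  have g₁₃ := g₃₁
  rw [real_inner_comm] at g₂₁ g₃₂ g₁₃
  -- For this Gram matrix `4v₁ + v₂ + v₃` is orthogonal to `v₂` and `v₃` and has squared norm
  -- `72/5`; `κ` normalizes it.
  obtain ⟨κ, hκ0, hκ⟩ : ∃ κ : ℝ, 0 < κ ∧ κ ^ 2 = 5 / 72 :=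
    ⟨√(5 / 72), by positivity, Real.sq_sqrt (by norm_num)⟩
  have hv := fun l m n : ℝ => norm_sq_comb_three (norm_S2 v₁) (norm_S2 v₂) (norm_S2 v₃) l m n
  simp only [g₁₂, g₁₃, g₂₃] at hv
  have hex : ∀ l m n : ℝ, l ^ 2 + m ^ 2 + n ^ 2 - 2 / 5 * (l * m + l * n + m * n) = 1 →
      ∃ p : S2, (p : E³) = l • (v₁ : E³) + m • (v₂ : E³) + n • (v₃ : E³) := fun l m n h =>
    ⟨⟨_, by
      rw [mem_sphere_zero_iff_norm, ← sq_eq_sq₀ (norm_nonneg _) zero_le_one, hv]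
      linarith⟩, rfl⟩
  obtain ⟨a, ha⟩ := hex (4 * κ) κ κ (by linarith)
  obtain ⟨b, hb⟩ := hex κ (4 * κ) κ (by linarith)
  obtain ⟨c, hc⟩ := hex κ κ (4 * κ) (by linarith)
  refine ⟨a, b, c, ?_, ?_, ?_, ?_⟩
  · constructor <;>
      simp only [ha, hb, hc, inner_add_right, real_inner_smul_right, inner_self_S2, g₁₂, g₂₁, g₂₃,
        g₃₂, g₃₁, g₁₃] <;> linarith
  all_goals
    rw [sphDist_eq_arccos]
    congr 1
    simp only [ha, hb, hc, inner_add_right, inner_add_left, real_inner_smul_right,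
      real_inner_smul_left, inner_self_S2, g₁₂, g₂₁, g₂₃, g₃₂, g₃₁, g₁₃]
    linarith

/-- Here `-v₁ + 2v₂ + 2v₃` has norm 3, while the three bounds already add up to `5 · 3/5 = 3`; hence
none of them is strict. -/
theorem inner_eq_of_extremal {v₁ v₂ v₃ z : S2} (g₁₂ : ⟪(v₁ : E³), v₂⟫ = -1 / 5)
    (g₂₃ : ⟪(v₂ : E³), v₃⟫ = -1 / 5) (g₃₁ : ⟪(v₃ : E³), v₁⟫ = -1 / 5)
    (k₁ : 3 / 5 ≤ -⟪(v₁ : E³), z⟫) (k₂ : 3 / 5 ≤ ⟪(v₂ : E³), z⟫) (k₃ : 3 / 5 ≤ ⟪(v₃ : E³), z⟫) :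
    ⟪(v₁ : E³), z⟫ = -(3 / 5) ∧ ⟪(v₂ : E³), z⟫ = 3 / 5 ∧ ⟪(v₃ : E³), z⟫ = 3 / 5 := by
  have hw : ‖(-1 : ℝ) • (v₁ : E³) + (2 : ℝ) • (v₂ : E³) + (2 : ℝ) • (v₃ : E³)‖ ^ 2 = 3 ^ 2 := by
    rw [norm_sq_comb_three (norm_S2 _) (norm_S2 _) (norm_S2 _), g₁₂, g₂₃, real_inner_comm, g₃₁]
    norm_num
  have hle := real_inner_le_norm
    ((-1 : ℝ) • (v₁ : E³) + (2 : ℝ) • (v₂ : E³) + (2 : ℝ) • (v₃ : E³)) z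
  rw [(sq_eq_sq₀ (norm_nonneg _) (by norm_num)).1 hw, norm_S2] at hle
  simp only [inner_add_left, real_inner_smul_left] at hle
  refine ⟨?_, ?_, ?_⟩ <;> linarith

theorem IsTSPackingOf.exists_isCuboctahedral {k : ℕ} (hk : 5 ≤ k) {F : Set (Set S2)}
    (h : IsTSPackingOf k (Real.arctan (3 / 4)) F) : ∃ P, IsCuboctahedral P ∧ F ⊆ P := by
  obtain ⟨h0, -, U, X, T, H, hT, hTX, hsep, hF⟩ := h.exists_isWideSystem (by omega)
  have h1 := arctan_three_fourths_mem.2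
  have hs := sin_arctan_three_fourths
  obtain ⟨v₁, hv₁, v₂, hv₂, v₃, hv₃, z₁, hz₁, z₂, hz₂, z₃, hz₃, hI⟩ :=
    H.exists_isolatesEach_of_five_le_card T hTX hsep (by omega)
  obtain ⟨g₁₂, g₂₃, g₃₁⟩ := hI.inner_eq hs (H.normU _ hv₁) (H.normU _ hv₂)
    (H.normU _ hv₃) (H.normX _ hz₁) (H.normX _ hz₂) (H.normX _ hz₃)
  obtain ⟨v₁, rfl⟩ : ∃ a : S2, (a : E³) = v₁ :=
    ⟨⟨v₁, mem_sphere_zero_iff_norm.2 (H.normU _ hv₁)⟩, rfl⟩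
  obtain ⟨v₂, rfl⟩ : ∃ b : S2, (b : E³) = v₂ :=
    ⟨⟨v₂, mem_sphere_zero_iff_norm.2 (H.normU _ hv₂)⟩, rfl⟩
  obtain ⟨v₃, rfl⟩ : ∃ c : S2, (c : E³) = v₃ :=
    ⟨⟨v₃, mem_sphere_zero_iff_norm.2 (H.normU _ hv₃)⟩, rfl⟩
  obtain ⟨a, b, c, hD, dab, dbc, dca⟩ := exists_isDualTriple g₁₂ g₂₃ g₃₁
  refine ⟨_, ⟨a, b, c, dab, dbc, dca, rfl⟩, fun C hC => ?_⟩
  obtain ⟨x, hx, rfl⟩ := hF C hC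
  have hext : ∃ z : S2, (z = x ∨ z = -x) ∧ |⟪(v₁ : E³), z⟫| = 3 / 5 ∧ |⟪(v₂ : E³), z⟫| = 3 / 5 ∧
      |⟪(v₃ : E³), z⟫| = 3 / 5 ∧
      (⟪(v₁ : E³), z⟫ < 0 ∨ ⟪(v₂ : E³), z⟫ < 0 ∨ ⟪(v₃ : E³), z⟫ < 0) ∧
      (0 < ⟪(v₁ : E³), z⟫ ∨ 0 < ⟪(v₂ : E³), z⟫) := by
    obtain ⟨z', -, e, hcases⟩ := H.sign_cases hv₁ hv₂ hv₃ hx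
    obtain ⟨z, rfl, hzx⟩ : ∃ z : S2, (z : E³) = z' ∧ (z = x ∨ z = -x) := by
      rcases e with rfl | rfl
      exacts [⟨x, rfl, .inl rfl⟩, ⟨-x, rfl, .inr rfl⟩]
    rw [hs] at hcases
    refine ⟨z, hzx, ?_⟩
    have p35 : |(3 / 5 : ℝ)| = 3 / 5 := abs_of_pos (by norm_num)
    rcases hcases with ⟨k₁, k₂, k₃⟩ | ⟨k₁, k₂, k₃⟩ | ⟨k₁, k₂, k₃⟩ | ⟨k₁, k₂, k₃⟩
    -- No center lies in a regular triangle: this would give `81/25 ≤ 3 - 6/5`.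
    · have := sq_le_of_inside (by norm_num) (norm_S2 _) (norm_S2 _) (norm_S2 _) (norm_S2 _) k₁ k₂ k₃
      rw [g₁₂, g₂₃, real_inner_comm, g₃₁] at this
      norm_num at this
    · obtain ⟨e₁, e₂, e₃⟩ := inner_eq_of_extremal g₁₂ g₂₃ g₃₁ k₁ k₂ k₃
      simp only [e₁, e₂, e₃, abs_neg, p35]
      norm_num
    · obtain ⟨e₂, e₃, e₁⟩ := inner_eq_of_extremal g₂₃ g₃₁ g₁₂ k₂ k₃ k₁
      simp only [e₁, e₂, e₃, abs_neg, p35]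
      norm_num
    · obtain ⟨e₃, e₁, e₂⟩ := inner_eq_of_extremal g₃₁ g₁₂ g₂₃ k₃ k₁ k₂
      simp only [e₁, e₂, e₃, abs_neg, p35]
      norm_num
  have hext' : |⟪(v₁ : E³), x⟫| = 3 / 5 ∧ |⟪(v₂ : E³), x⟫| = 3 / 5 ∧ |⟪(v₃ : E³), x⟫| = 3 / 5 ∧
      (⟪(v₁ : E³), x⟫ < 0 ∨ ⟪(v₂ : E³), x⟫ < 0 ∨ ⟪(v₃ : E³), x⟫ < 0) ∧
      (0 < ⟪(v₁ : E³), x⟫ ∨ 0 < ⟪(v₂ : E³), x⟫ ∨ 0 < ⟪(v₃ : E³), x⟫) := by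
    obtain ⟨z, rfl | rfl, a₁, a₂, a₃, hn, hp⟩ := hext
    · exact ⟨a₁, a₂, a₃, hn, by tauto⟩
    · simp only [coe_neg_sphere, inner_neg_right, abs_neg, Left.neg_neg_iff, Left.neg_pos_iff]
        at a₁ a₂ a₃ hn hp
      exact ⟨a₁, a₂, a₃, by tauto, hn⟩
  obtain ⟨a₁, a₂, a₃, hn, hp⟩ := hext'
  rw [← hs] at a₁ a₂ a₃
  obtain ⟨p, q, t, ep, eq, et, m₁, m₂, m₃, hins⟩ := hD.exists_isInscribedCap h0 h1 a₁ a₂ a₃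
  refine ⟨p, q, t, ep, eq, et, ?_, ?_, hins⟩
  · rintro ⟨rfl, rfl, rfl⟩
    rcases hn with hn | hn | hn
    · nlinarith [hD.h₁₁]
    · nlinarith [hD.h₂₂]
    · nlinarith [hD.h₃₃]
  · rintro ⟨rfl, rfl, rfl⟩
    rw [coe_neg_sphere, inner_neg_right] at m₁ m₂ m₃
    rcases hp with hp | hp | hp
    · nlinarith [hD.h₁₁]
    · nlinarith [hD.h₂₂]
    · nlinarith [hD.h₃₃]

/-! ### Packings that attain the bounds -/

theorem inner_toLp_three (a b c a' b' c' : ℝ) :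
    ⟪(!₂[a, b, c] : E³), !₂[a', b', c']⟫ = a * a' + b * b' + c * c' := by
  simp [PiLp.inner_apply, Fin.sum_univ_three, mul_comm]

theorem exists_S2_toLp {a b c : ℝ} (h : a ^ 2 + b ^ 2 + c ^ 2 = 1) :
    ∃ x : S2, (x : E³) = !₂[a, b, c] :=
  ⟨⟨!₂[a, b, c], by
    rw [mem_sphere_zero_iff_norm, ← sq_eq_sq₀ (norm_nonneg _) zero_le_one,
      ← real_inner_self_eq_norm_sq, inner_toLp_three]
    linarith⟩, rfl⟩

theorem arcsin_mem_tsRadii {k : ℕ} (hk : k ≤ 8) : Real.arcsin (1 / √3) ∈ tsRadii k := by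
  obtain ⟨h0, h1⟩ := arcsin_one_div_sqrt_three_mem
  let σ : Bool → ℝ := fun i => if i then 1 / √3 else -(1 / √3)
  have hpos : (0 : ℝ) < 1 / √3 := by positivity
  have hσ : ∀ i, σ i ^ 2 = 1 / 3 := by
    intro i
    cases i <;> simp only [σ, ↓reduceIte, Bool.false_eq_true, neg_sq, one_div_sqrt_three_sq]
  have hσa : ∀ i, 1 / √3 ≤ |σ i| := by
    intro i
    cases i <;> simp only [σ, ↓reduceIte, Bool.false_eq_true, abs_neg] <;> exact le_abs_self _
  have hσs : ∀ i j, i ≠ j → σ i * σ j < 0 := by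
    intro i j hij
    cases i <;> cases j <;> simp only [σ, ↓reduceIte, Bool.false_eq_true, ne_eq, not_true] at * <;>
      nlinarith
  choose x hx using fun i : Bool × Bool × Bool =>
    exists_S2_toLp (a := σ i.1) (b := σ i.2.1) (c := σ i.2.2)
      (by rw [hσ, hσ, hσ]; norm_num)
  obtain ⟨a, ha⟩ := exists_S2_toLp (a := 1) (b := 0) (c := 0) (by norm_num)
  obtain ⟨b, hb⟩ := exists_S2_toLp (a := 0) (b := 1) (c := 0) (by norm_num)
  obtain ⟨c, hc⟩ := exists_S2_toLp (a := 0) (b := 0) (c := 1) (by norm_num)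
  have ia : ∀ i, ⟪(a : E³), x i⟫ = σ i.1 := fun i => by rw [ha, hx, inner_toLp_three]; ring
  have ib : ∀ i, ⟪(b : E³), x i⟫ = σ i.2.1 := fun i => by rw [hb, hx, inner_toLp_three]; ring
  have ic : ∀ i, ⟪(c : E³), x i⟫ = σ i.2.2 := fun i => by rw [hc, hx, inner_toLp_three]; ring
  refine mem_tsRadii_of_centers h0 h1.le x {a, b, c} ?_ ?_ (by simpa using hk)
  · rw [sin_arcsin_one_div_sqrt_three]
    rintro w (rfl | rfl | rfl) i
    · rw [ia]; exact hσa _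
    · rw [ib]; exact hσa _
    · rw [ic]; exact hσa _
  · intro i j hij
    by_cases h₁ : i.1 = j.1
    · by_cases h₂ : i.2.1 = j.2.1
      · have h₃ : i.2.2 ≠ j.2.2 := fun h₃ => hij (Prod.ext h₁ (Prod.ext h₂ h₃))
        exact ⟨c, by simp, by rw [ic, ic]; exact hσs _ _ h₃⟩
      · exact ⟨b, by simp, by rw [ib, ib]; exact hσs _ _ h₂⟩
    · exact ⟨a, by simp, by rw [ia, ia]; exact hσs _ _ h₁⟩

/-- Three vectors at equal height `κ`, rotated by `2π/3` about the third axis. -/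
theorem exists_unit_triple :
    ∃ v : Fin 3 → S2, ∀ i j, ⟪(v i : E³), v j⟫ = if i = j then 1 else -1 / 5 := by
  obtain ⟨κ, hκ⟩ : ∃ κ : ℝ, κ ^ 2 = 1 / 5 := ⟨√(1 / 5), Real.sq_sqrt (by norm_num)⟩
  have h3 : √3 ^ 2 = (3 : ℝ) := Real.sq_sqrt (by norm_num)
  have hκ3 : (√3 * κ) ^ 2 = 3 / 5 := by rw [mul_pow, h3, hκ]; norm_num
  obtain ⟨a, ha⟩ := exists_S2_toLp (a := 2 * κ) (b := 0) (c := κ) (by linarith)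
  obtain ⟨b, hb⟩ := exists_S2_toLp (a := -κ) (b := √3 * κ) (c := κ) (by linarith)
  obtain ⟨c, hc⟩ := exists_S2_toLp (a := -κ) (b := -(√3 * κ)) (c := κ) (by linarith)
  refine ⟨![a, b, c], fun i j => ?_⟩
  have hab : ⟪(a : E³), b⟫ = -1 / 5 := by rw [ha, hb, inner_toLp_three]; linarith
  have hbc : ⟪(b : E³), c⟫ = -1 / 5 := by rw [hb, hc, inner_toLp_three]; linarith
  have hca : ⟪(c : E³), a⟫ = -1 / 5 := by rw [hc, ha, inner_toLp_three]; linarith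
  have hba := hab
  have hcb := hbc
  have hac := hca
  rw [real_inner_comm] at hba hcb hac
  fin_cases i <;> fin_cases j <;> simp [hab, hbc, hca, hba, hcb, hac]

theorem arctan_mem_tsRadii {k : ℕ} (hk : k ≤ 6) : Real.arctan (3 / 4) ∈ tsRadii k := by
  obtain ⟨h0, h1⟩ := arctan_three_fourths_mem
  obtain ⟨v, hv⟩ := exists_unit_triple
  have hsum : ∀ (p q : ℝ) (j : Fin 3), ∑ i, (if i = j then p else q) = p + 2 * q := by
    intro p q j
    obtain rfl | rfl | rfl : j = 0 ∨ j = 1 ∨ j = 2 := by omega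
    all_goals simp [Fin.sum_univ_three]; ring
  have hmem : ∀ j : Fin 3, ∃ z : S2, ∀ i, ⟪(v i : E³), z⟫ = if i = j then -(3 / 5) else 3 / 5 := by
    intro j
    -- This is `(-v₁ + 2v₂ + 2v₃) / 3` for `j` in the role of the first index, the equality case of
    -- Cauchy-Schwarz.
    let y : E³ := (2 / 3 : ℝ) • ∑ i, (v i : E³) - (v j : E³)
    have hy : ∀ i, ⟪(v i : E³), y⟫ = if i = j then -(3 / 5) else 3 / 5 := by
      intro i
      simp only [y, inner_sub_right, real_inner_smul_right, inner_sum, hv, eq_comm (a := i), hsum]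
      split_ifs <;> norm_num
    refine ⟨⟨y, ?_⟩, hy⟩
    rw [mem_sphere_zero_iff_norm, ← sq_eq_sq₀ (norm_nonneg _) zero_le_one,
      ← real_inner_self_eq_norm_sq]
    conv_lhs => arg 2; rw [show y = (2 / 3 : ℝ) • ∑ i, (v i : E³) - (v j : E³) from rfl]
    simp only [inner_sub_left, real_inner_smul_left, sum_inner, hy, hsum, ↓reduceIte]
    norm_num
  choose z hz using hmem
  let x : Bool × Fin 3 → S2 := fun i => if i.1 then z i.2 else -z i.2
  have hx : ∀ w : S2, ∀ i, ⟪(w : E³), x i⟫ =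
      (if i.1 then 1 else -1) * ⟪(w : E³), z i.2⟫ := by
    rintro w ⟨i, j⟩
    cases i <;> simp [x]
  refine mem_tsRadii_of_centers h0 h1.le x (Set.range v) ?_ ?_ (by simpa using hk)
  · rw [sin_arctan_three_fourths]
    rintro _ ⟨l, rfl⟩ ⟨i, j⟩
    rw [hx, hz]
    apply le_of_eq
    cases i <;> split_ifs <;> norm_num [abs_of_pos, abs_of_neg]
  · rintro ⟨i, j⟩ ⟨i', j'⟩ hne
    -- Only signs matter for separation, so it reduces to a finite check on the six sign patterns
    -- other than `+++` and `---`.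
    have : ∃ l : Fin 3, (if l = j then (-1 : ℤ) else 1) * (if l = j' then -1 else 1) *
        ((if i then 1 else -1) * (if i' then 1 else -1)) < 0 := by
      revert i j i' j'
      decide
    obtain ⟨l, hl⟩ := this
    refine ⟨v l, ⟨l, rfl⟩, ?_⟩
    rw [hx, hx, hz, hz]
    cases i <;> cases i' <;> split_ifs at hl ⊢ <;> first | (norm_num at hl; done) | norm_num

end Extremal

theorem mainTheorem2 :
    (∀ k : ℕ, 5 ≤ k → k ≤ 6 →
      IsGreatest (tsRadii k) (rSTam k) ∧ rSTam k = Real.arctan (3 / 4) ∧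
      ∀ F : Set (Set S2), IsOptimal k F → ∃ P : Set (Set S2), IsCuboctahedral P ∧ F ⊆ P) ∧
    (∀ k : ℕ, 7 ≤ k → k ≤ 8 →
      IsGreatest (tsRadii k) (rSTam k) ∧ rSTam k = Real.arcsin (1 / √3) ∧
      ∀ F : Set (Set S2), IsOptimal k F → ∃ P : Set (Set S2), IsOctahedral P ∧ F ⊆ P) := by

  refine ⟨fun k h5 h6 => ?_, fun k h7 h8 => ?_⟩
  · have hg : IsGreatest (tsRadii k) (Real.arctan (3 / 4)) :=
      ⟨arctan_mem_tsRadii h6, fun r ⟨F, hF⟩ => hF.le_arctan h5⟩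
    have he : rSTam k = Real.arctan (3 / 4) := hg.csSup_eq
    refine ⟨he ▸ hg, he, fun F hF => ?_⟩
    unfold IsOptimal at hF
    rw [he] at hF
    exact hF.exists_isCuboctahedral h5
  · have hg : IsGreatest (tsRadii k) (Real.arcsin (1 / √3)) :=
      ⟨arcsin_mem_tsRadii h8, fun r ⟨F, hF⟩ => hF.le_arcsin h7⟩
    have he : rSTam k = Real.arcsin (1 / √3) := hg.csSup_eq
    refine ⟨he ▸ hg, he, fun F hF => ?_⟩
    unfold IsOptimal at hF
    rw [he] at hF
    exact hF.exists_isOctahedral h7
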